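/- Let $n\ge 1$ and $1<p<\infty$. A cube in $\mathbb{R}^n$ means an open cube with edges parallel to the coordinate axes; write $|Q|$ for its Lebesgue measure and $f_Q=\frac1{|Q|}\int_Q f$. Let $JN_p(\mathbb{R}^n)$ be the space of all functions $f\in L^1_{\mathrm{loc}}(\mathbb{R}^n)$ (real-valued) for which there is a constant $K<\infty$ such that $$\sum_{i} |Q_i|\left(\frac1{|Q_i|}\int_{Q_i}|f-f_{Q_i}|\right)^p\le K^p$$ for all countable collections $(Q_i)$ of pairwise disjoint cubes in $\mathbb{R}^n$, and let $\|f\|_{JN_p}$ be the smallest such $K$ (a seminorm on $JN_p(\mathbb{R}^n)$). Let $CJN_p(\mathbb{R}^n)$ be the closure of $C_c^\infty(\mathbb{R}^n)$ in $JN_p(\mathbb{R}^n)$ with respect to $\|\cdot\|_{JN_p}$, and let $VJN_p(\mathbb{R}^n)$ be the closure, in the same sense, of $$\{f\in C^\infty(\mathbb{R}^n): |\nabla f|\in L^p(\mathbb{R}^n)\}\cap JN_p(\mathbb{R}^n).$$ Then $CJN_p(\mathbb{R}^n)=VJN_p(\mathbb{R}^n)$. -/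

import Mathlib

open MeasureTheory Set
open scoped ENNReal ContDiff

noncomputable section

namespace JohnNirenberg

/-- The data of an open cube in `ℝⁿ` with edges parallel to the coordinate axes:
its lower corner and its (positive) side length. -/
structure Cube (n : ℕ) where
  corner : EuclideanSpace ℝ (Fin n)
  side : ℝ
  side_pos : 0 < side

/-- The open cube `∏ᵢ (cᵢ, cᵢ + ℓ)` as a subset of `ℝⁿ`. -/
def Cube.toSet {n : ℕ} (Q : Cube n) : Set (EuclideanSpace ℝ (Fin n)) :=
  {x | ∀ i, x i ∈ Ioo (Q.corner i) (Q.corner i + Q.side)}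

/-- The mean oscillation `⨍_Q |f - f_Q|`, where `f_Q = ⨍_Q f`. -/
def meanOsc {n : ℕ} (f : EuclideanSpace ℝ (Fin n) → ℝ) (Q : Cube n) : ℝ :=
  ⨍ x in Q.toSet, |f x - ⨍ y in Q.toSet, f y ∂volume| ∂volume

/-- The sum `∑ |Q| (⨍_Q |f - f_Q|)^p` over the cubes `Q` of a collection. -/
def oscSum {n : ℕ} (p : ℝ) (f : EuclideanSpace ℝ (Fin n) → ℝ) (𝒬 : Set (Cube n)) : ℝ≥0∞ :=
  ∑' Q : 𝒬, volume (Q : Cube n).toSet * ENNReal.ofReal (meanOsc f (Q : Cube n)) ^ p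

/-- The John–Nirenberg seminorm `‖f‖_{JN_p(ℝⁿ)}`: the `p`-th root of the supremum of the
oscillation sums over all countable collections of pairwise disjoint cubes. -/
def jnNorm {n : ℕ} (p : ℝ) (f : EuclideanSpace ℝ (Fin n) → ℝ) : ℝ≥0∞ :=
  (⨆ (𝒬 : Set (Cube n)) (_ : 𝒬.Countable) (_ : 𝒬.PairwiseDisjoint Cube.toSet),
    oscSum p f 𝒬) ^ (1 / p)

/-- `jnNorm p f` is the smallest `K` such that all the oscillation sums are at most `K ^ p`. -/
theorem jnNorm_le_iff {n : ℕ} {p : ℝ} (hp : 0 < p) (f : EuclideanSpace ℝ (Fin n) → ℝ)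
    (K : ℝ≥0∞) :
    jnNorm p f ≤ K ↔ ∀ 𝒬 : Set (Cube n), 𝒬.Countable → 𝒬.PairwiseDisjoint Cube.toSet →
      oscSum p f 𝒬 ≤ K ^ p := by
  unfold jnNorm
  rw [one_div, ENNReal.rpow_inv_le_iff hp]
  simp only [iSup_le_iff]

/-- The John–Nirenberg space `JN_p(ℝⁿ)`. -/
def JN (n : ℕ) (p : ℝ) : Set (EuclideanSpace ℝ (Fin n) → ℝ) :=
  {f | LocallyIntegrable f volume ∧ jnNorm p f < ⊤}

/-- The closure of `S` in `JN_p(ℝⁿ)` with respect to the seminorm `‖·‖_{JN_p}`. -/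
def jnClosure {n : ℕ} (p : ℝ) (S : Set (EuclideanSpace ℝ (Fin n) → ℝ)) :
    Set (EuclideanSpace ℝ (Fin n) → ℝ) :=
  {f | f ∈ JN n p ∧ ∀ ε : ℝ≥0∞, 0 < ε → ∃ g ∈ S, jnNorm p (f - g) < ε}

/-- The smooth functions `f` on `ℝⁿ` with `|∇f| ∈ L^p(ℝⁿ)`. -/
def smoothGradLp (n : ℕ) (p : ℝ) : Set (EuclideanSpace ℝ (Fin n) → ℝ) :=
  {f | ContDiff ℝ ∞ f ∧ MemLp (fun x => ‖gradient f x‖) (ENNReal.ofReal p) volume}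

/-- The smooth functions on `ℝⁿ` with compact support. -/
def smoothCompact (n : ℕ) : Set (EuclideanSpace ℝ (Fin n) → ℝ) :=
  {f | ContDiff ℝ ∞ f ∧ HasCompactSupport f}

/-- The vanishing subspace `VJN_p(ℝⁿ)`. -/
def VJN (n : ℕ) (p : ℝ) : Set (EuclideanSpace ℝ (Fin n) → ℝ) :=
  jnClosure p (smoothGradLp n p ∩ JN n p)

/-- The vanishing subspace `CJN_p(ℝⁿ)`. -/
def CJN (n : ℕ) (p : ℝ) : Set (EuclideanSpace ℝ (Fin n) → ℝ) :=
  jnClosure p (smoothCompact n)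

end JohnNirenberg

end

open MeasureTheory Set
open scoped ENNReal ContDiff

noncomputable section

namespace JohnNirenberg

variable {n : ℕ}

/-! ### Cubes -/

/-! The inclusion of `CJN` in `VJN` is soft: a compactly supported smooth function has its gradient
in L^p, and it lies in JN_p as soon as it is at finite distance from an element of JN_p.

For the converse it suffices to approximate a smooth g in JN_p by φ (g - b), where φ is a smooth
cutoff at scale L and b a suitable constant. The seminorm ignores constants, so the error is the
seminorm of ψ u with ψ = 1 - φ and u = g - b. Three facts make it small.

Tails (`exists_box_oscSum_le`): the supremum of the oscillation sums is finite, so sums over cubes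
avoiding a large box are small.

Decay (`exists_morrey_centredCube_le`): if b is the limit of the averages of g over growing centred
cubes, then |Q| (⨍_Q |u|)^p tends to 0 along centred cubes Q. The outer shell of Q is covered by 2n
cubes far from the origin, on which the averages of |u| are o(|Q|^(-1/p)) by the tail estimate. The
core enters the average over Q with weight 2^(-n), which is less than 2^(-n/p) because p > 1, so the
resulting recursion contracts.

Cutting off (`exists_oscSum_cutoff_le`): large cubes meeting the transition region are boundedly
many and are handled by decay. On a small cube, osc(ψ u) is at most a constant times osc(u) +
(side/L) ⨍|u|. The first term is a tail. The second is compared with a dyadic grid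
(`tsum_side_rpow_mul_morrey_le`): the sum of |P| (⨍_P |u|)^p over a generation grows by 2^(p-1) per
step, up to an oscillation sum, while the weight (side/L)^p gains 2^(-p). The series over
generations thus converges like ∑ (k + 1) 2^(-k), starting from a generation controlled by decay. -/

theorem Cube.toSet_eq_preimage (Q : Cube n) :
    Q.toSet = (MeasurableEquiv.toLp 2 (Fin n → ℝ)).symm ⁻¹'
      (univ.pi fun i => Ioo (Q.corner i) (Q.corner i + Q.side)) := by
  ext x
  simp [Cube.toSet, Set.mem_pi]

theorem Cube.isOpen (Q : Cube n) : IsOpen Q.toSet := by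
  have : Q.toSet = ⋂ i, (fun x : EuclideanSpace ℝ (Fin n) => x i) ⁻¹'
      Ioo (Q.corner i) (Q.corner i + Q.side) := by
    ext x
    simp [Cube.toSet]
  rw [this]
  exact isOpen_iInter_of_finite fun i => isOpen_Ioo.preimage (by fun_prop)

theorem Cube.measurableSet (Q : Cube n) : MeasurableSet Q.toSet := Q.isOpen.measurableSet

theorem Cube.volume_toSet (Q : Cube n) : volume Q.toSet = ENNReal.ofReal Q.side ^ n := by
  rw [Q.toSet_eq_preimage,
    (EuclideanSpace.volume_preserving_symm_measurableEquiv_toLp (Fin n)).measure_preimage_equiv,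
    Real.volume_pi_Ioo]
  simp

theorem Cube.volume_pos (Q : Cube n) : 0 < volume Q.toSet := by
  rw [Q.volume_toSet]
  exact ENNReal.pow_pos (ENNReal.ofReal_pos.2 Q.side_pos) n

theorem Cube.volume_ne_zero (Q : Cube n) : volume Q.toSet ≠ 0 := Q.volume_pos.ne'

theorem Cube.volume_ne_top (Q : Cube n) : volume Q.toSet ≠ ⊤ := by
  rw [Q.volume_toSet]
  exact ENNReal.pow_ne_top ENNReal.ofReal_ne_top

theorem Cube.nonempty (Q : Cube n) : Q.toSet.Nonempty :=
  nonempty_of_measure_ne_zero Q.volume_ne_zero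

theorem Cube.isBounded (Q : Cube n) : Bornology.IsBounded Q.toSet := by
  have : Q.toSet ⊆ (EuclideanSpace.equiv (Fin n) ℝ) ⁻¹'
      (Icc Q.corner.ofLp (fun i => Q.corner i + Q.side)) := by
    intro x hx
    exact ⟨fun i => (hx i).1.le, fun i => (hx i).2.le⟩
  refine Bornology.IsBounded.subset ?_ this
  have h : IsCompact ((EuclideanSpace.equiv (Fin n) ℝ).toHomeomorph ⁻¹'
      (Icc Q.corner.ofLp (fun i => Q.corner i + Q.side))) :=
    (Homeomorph.isCompact_preimage _).2 isCompact_Icc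
  exact h.isBounded

theorem Cube.volume_le_of_subset {Q Q' : Cube n} (c : ℝ) (hc : 0 ≤ c) (h : Q'.side ≤ c * Q.side) :
    volume Q'.toSet ≤ ENNReal.ofReal c ^ n * volume Q.toSet := by
  rw [Q.volume_toSet, Q'.volume_toSet, ← mul_pow, ← ENNReal.ofReal_mul hc]
  gcongr

/-- The centred cube `(-R, R)ⁿ`, as a set. -/
def box (n : ℕ) (R : ℝ) : Set (EuclideanSpace ℝ (Fin n)) := {x | ∀ i, |x i| < R}

/-- The centred cube `(-R, R)ⁿ`. -/
def centredCube (n : ℕ) (R : ℝ) (hR : 0 < R) : Cube n where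
  corner := WithLp.toLp 2 fun _ => -R
  side := 2 * R
  side_pos := by positivity

theorem centredCube_toSet {R : ℝ} (hR : 0 < R) : (centredCube n R hR).toSet = box n R := by
  ext x
  simp only [Cube.toSet, centredCube, box, mem_ofPred_eq, mem_Ioo, abs_lt]
  refine forall_congr' fun i => and_congr_right fun _ => ?_
  rw [show -R + 2 * R = R by ring]

theorem box_mono {R S : ℝ} (h : R ≤ S) : box n R ⊆ box n S := fun _ hx i => (hx i).trans_le h

theorem Cube.exists_subset_box (Q : Cube n) : ∃ R, Q.toSet ⊆ box n R := by
  obtain ⟨R, hR⟩ := Q.isBounded.subset_closedBall 0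
  refine ⟨R + 1, fun x hx i => ?_⟩
  have h1 : ‖x‖ ≤ R := by simpa using hR hx
  have h2 := PiLp.norm_apply_le x i
  rw [Real.norm_eq_abs] at h2
  linarith

/-- If `Q` meets `box n R`, then it lies in `box n (R + Q.side)`. -/
theorem Cube.subset_box_add {Q : Cube n} {R : ℝ} (h : (Q.toSet ∩ box n R).Nonempty) :
    Q.toSet ⊆ box n (R + Q.side) := by
  obtain ⟨y, hyQ, hy⟩ := h
  intro x hx i
  have h1 := hx i
  have h2 := hyQ i
  have h3 := hy i
  rw [abs_lt] at h3 ⊢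
  constructor <;> linarith [h1.1, h1.2, h2.1, h2.2]

/-- If `Q` has a point outside `box n R`, then it is disjoint from `box n (R - Q.side)`. -/
theorem Cube.disjoint_box_sub {Q : Cube n} {R : ℝ} (h : ¬ Q.toSet ⊆ box n R) :
    Disjoint Q.toSet (box n (R - Q.side)) := by
  rw [Set.disjoint_left]
  intro x hx hxR
  have := Q.subset_box_add (R := R - Q.side) ⟨x, hx, hxR⟩
  rw [sub_add_cancel] at this
  exact h this

/-! ### Averages and oscillations -/

/-- The average `f_Q`. -/
def avg (f : EuclideanSpace ℝ (Fin n) → ℝ) (Q : Cube n) : ℝ := ⨍ x in Q.toSet, f x ∂volume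

/-- The average of `|u|` over `Q`, as an extended nonnegative real. -/
def eavg (u : EuclideanSpace ℝ (Fin n) → ℝ) (Q : Cube n) : ℝ≥0∞ :=
  (volume Q.toSet)⁻¹ * ∫⁻ x in Q.toSet, ‖u x‖ₑ

/-- The mean oscillation, as an extended nonnegative real. -/
def eosc (f : EuclideanSpace ℝ (Fin n) → ℝ) (Q : Cube n) : ℝ≥0∞ := ENNReal.ofReal (meanOsc f Q)

theorem oscSum_eq (p : ℝ) (f : EuclideanSpace ℝ (Fin n) → ℝ) (𝒬 : Set (Cube n)) :
    oscSum p f 𝒬 = ∑' Q : 𝒬, volume (Q : Cube n).toSet * eosc f Q ^ p := rfl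

theorem integrableOn_cube {f : EuclideanSpace ℝ (Fin n) → ℝ} (hf : LocallyIntegrable f volume)
    (Q : Cube n) : IntegrableOn f Q.toSet volume :=
  (hf.integrableOn_isCompact Q.isBounded.isCompact_closure).mono_set subset_closure

theorem eosc_eq {f : EuclideanSpace ℝ (Fin n) → ℝ} (hf : LocallyIntegrable f volume)
    (Q : Cube n) : eosc f Q = eavg (fun x => f x - avg f Q) Q := by
  have h1 : IntegrableOn (fun x => |f x - avg f Q|) Q.toSet volume :=
    ((integrableOn_cube hf Q).sub (integrableOn_const Q.volume_ne_top)).abs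
  unfold eosc meanOsc eavg
  change ENNReal.ofReal (⨍ x in Q.toSet, |f x - avg f Q|) = _
  rw [ofReal_setAverage h1 (ae_of_all _ fun x => abs_nonneg _), ENNReal.div_eq_inv_mul]
  simp only [← Real.norm_eq_abs, ofReal_norm]

theorem eavg_mono {u v : EuclideanSpace ℝ (Fin n) → ℝ} {Q : Cube n}
    (h : ∀ x ∈ Q.toSet, ‖u x‖ₑ ≤ ‖v x‖ₑ) : eavg u Q ≤ eavg v Q := by
  unfold eavg
  gcongr 1
  exact setLIntegral_mono_ae' Q.measurableSet (ae_of_all _ h)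

theorem eavg_congr {u v : EuclideanSpace ℝ (Fin n) → ℝ} {Q : Cube n}
    (h : ∀ x ∈ Q.toSet, u x = v x) : eavg u Q = eavg v Q :=
  le_antisymm (eavg_mono fun x hx => by rw [h x hx]) (eavg_mono fun x hx => by rw [h x hx])

theorem eavg_const (c : ℝ) (Q : Cube n) : eavg (fun _ => c) Q = ‖c‖ₑ := by
  unfold eavg
  rw [setLIntegral_const, mul_comm, mul_assoc, ENNReal.mul_inv_cancel Q.volume_ne_zero
    Q.volume_ne_top, mul_one]

theorem eavg_add_le {u v : EuclideanSpace ℝ (Fin n) → ℝ} {w : EuclideanSpace ℝ (Fin n) → ℝ}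
    {Q : Cube n} (hu : AEMeasurable u (volume.restrict Q.toSet))
    (h : ∀ x ∈ Q.toSet, ‖w x‖ₑ ≤ ‖u x‖ₑ + ‖v x‖ₑ) : eavg w Q ≤ eavg u Q + eavg v Q := by
  unfold eavg
  rw [← mul_add, ← lintegral_add_left' hu.enorm]
  gcongr 1
  exact setLIntegral_mono_ae' Q.measurableSet (ae_of_all _ h)

theorem enorm_avg_le (u : EuclideanSpace ℝ (Fin n) → ℝ) (Q : Cube n) :
    ‖avg u Q‖ₑ ≤ eavg u Q := by
  unfold avg eavg
  rw [setAverage_eq, enorm_smul]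
  have h : ‖(volume.real Q.toSet)⁻¹‖ₑ = (volume Q.toSet)⁻¹ := by
    rw [enorm_inv, Real.enorm_eq_ofReal measureReal_nonneg, ofReal_measureReal Q.volume_ne_top]
    · exact (measureReal_ne_zero_iff Q.volume_ne_top).2 Q.volume_ne_zero
  rw [h]
  gcongr
  exact enorm_integral_le_lintegral_enorm _

theorem eavg_ne_top {u : EuclideanSpace ℝ (Fin n) → ℝ} (hu : LocallyIntegrable u volume)
    (Q : Cube n) : eavg u Q ≠ ⊤ :=
  ENNReal.mul_ne_top (ENNReal.inv_ne_top.2 Q.volume_ne_zero) (integrableOn_cube hu Q).2.ne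

theorem avg_sub_const {f : EuclideanSpace ℝ (Fin n) → ℝ} (hf : LocallyIntegrable f volume)
    (c : ℝ) (Q : Cube n) : avg (fun x => f x - c) Q = avg f Q - c := by
  unfold avg
  have hv : volume.real Q.toSet ≠ 0 :=
    (measureReal_ne_zero_iff Q.volume_ne_top).2 Q.volume_ne_zero
  rw [setAverage_eq, setAverage_eq, integral_sub (integrableOn_cube hf Q)
    (integrableOn_const Q.volume_ne_top), setIntegral_const, smul_sub, smul_smul,
    inv_mul_cancel₀ hv, one_smul]

theorem avg_add {f g : EuclideanSpace ℝ (Fin n) → ℝ} (hf : LocallyIntegrable f volume)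
    (hg : LocallyIntegrable g volume) (Q : Cube n) : avg (f + g) Q = avg f Q + avg g Q := by
  unfold avg
  simp only [setAverage_eq, Pi.add_apply]
  rw [integral_add (integrableOn_cube hf Q) (integrableOn_cube hg Q), smul_add]

theorem aemeasurable_cube {f : EuclideanSpace ℝ (Fin n) → ℝ} (hf : LocallyIntegrable f volume)
    (Q : Cube n) : AEMeasurable f (volume.restrict Q.toSet) :=
  (integrableOn_cube hf Q).1.aemeasurable

theorem eosc_add_le {f g : EuclideanSpace ℝ (Fin n) → ℝ} (hf : LocallyIntegrable f volume)
    (hg : LocallyIntegrable g volume) (Q : Cube n) :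
    eosc (f + g) Q ≤ eosc f Q + eosc g Q := by
  rw [eosc_eq hf, eosc_eq hg, eosc_eq (hf.add hg), avg_add hf hg]
  refine eavg_add_le ((aemeasurable_cube hf Q).sub_const _) fun x _ => ?_
  rw [Pi.add_apply, add_sub_add_comm]
  exact enorm_add_le _ _

theorem eosc_neg {f : EuclideanSpace ℝ (Fin n) → ℝ} (hf : LocallyIntegrable f volume)
    (Q : Cube n) : eosc (-f) Q = eosc f Q := by
  have h : avg (-f) Q = - avg f Q := by
    unfold avg
    simp only [setAverage_eq, Pi.neg_apply, integral_neg, smul_neg]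
  rw [eosc_eq hf, eosc_eq hf.neg, h]
  unfold eavg
  congr 2 with x
  change ‖-f x - -avg f Q‖ₑ = ‖f x - avg f Q‖ₑ
  rw [← enorm_neg]
  congr 1
  ring

theorem locallyIntegrable_sub_const {f : EuclideanSpace ℝ (Fin n) → ℝ}
    (hf : LocallyIntegrable f volume) (c : ℝ) :
    LocallyIntegrable (fun x => f x - c) volume :=
  hf.sub (locallyIntegrable_const c)

theorem eosc_sub_const {f : EuclideanSpace ℝ (Fin n) → ℝ} (hf : LocallyIntegrable f volume)
    (c : ℝ) (Q : Cube n) : eosc (fun x => f x - c) Q = eosc f Q := by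
  rw [eosc_eq hf, eosc_eq (locallyIntegrable_sub_const hf c), avg_sub_const hf]
  simp

/-- The mean is a nearly optimal constant: replacing it by c costs |f_Q - c|, itself at most the
average of |f - c|. -/
theorem eosc_le_two_mul {f : EuclideanSpace ℝ (Fin n) → ℝ} (hf : LocallyIntegrable f volume)
    (c : ℝ) (Q : Cube n) : eosc f Q ≤ 2 * eavg (fun x => f x - c) Q := by
  have h1 := enorm_avg_le (fun x => f x - c) Q
  rw [eosc_eq hf, two_mul]
  calc eavg (fun x => f x - avg f Q) Q
      ≤ eavg (fun x => f x - c) Q + eavg (fun _ => avg (fun x => f x - c) Q) Q := by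
        refine eavg_add_le ((aemeasurable_cube hf Q).sub_const _) fun x _ => ?_
        rw [avg_sub_const hf, show f x - avg f Q = (f x - c) - (avg f Q - c) by ring]
        exact enorm_sub_le
    _ ≤ _ := by rw [eavg_const]; gcongr

theorem eosc_le_two_mul_eavg {f : EuclideanSpace ℝ (Fin n) → ℝ}
    (hf : LocallyIntegrable f volume) (Q : Cube n) : eosc f Q ≤ 2 * eavg f Q := by
  simpa using eosc_le_two_mul hf 0 Q

theorem eosc_congr {f g : EuclideanSpace ℝ (Fin n) → ℝ} (hf : LocallyIntegrable f volume)
    (hg : LocallyIntegrable g volume) {Q : Cube n} (h : ∀ x ∈ Q.toSet, f x = g x) :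
    eosc f Q = eosc g Q := by
  have h1 : avg f Q = avg g Q := by
    unfold avg
    rw [setAverage_eq, setAverage_eq, setIntegral_congr_fun Q.measurableSet h]
  rw [eosc_eq hf, eosc_eq hg, h1]
  exact eavg_congr fun x hx => by rw [h x hx]

/-- Averages over a cube are controlled by those over a larger cube of comparable size. -/
theorem eavg_le_of_subset (u : EuclideanSpace ℝ (Fin n) → ℝ) {Q Q' : Cube n}
    (h : Q.toSet ⊆ Q'.toSet) {c : ℝ≥0∞} (hc : volume Q'.toSet ≤ c * volume Q.toSet) :
    eavg u Q ≤ c * eavg u Q' := by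
  unfold eavg
  rw [← mul_assoc]
  gcongr
  calc (volume Q.toSet)⁻¹
      = (volume Q.toSet)⁻¹ * (volume Q'.toSet * (volume Q'.toSet)⁻¹) := by
        rw [ENNReal.mul_inv_cancel Q'.volume_ne_zero Q'.volume_ne_top, mul_one]
    _ ≤ (volume Q.toSet)⁻¹ * (c * volume Q.toSet * (volume Q'.toSet)⁻¹) := by gcongr
    _ = (volume Q.toSet)⁻¹ * volume Q.toSet * (c * (volume Q'.toSet)⁻¹) := by ring
    _ = _ := by rw [ENNReal.inv_mul_cancel Q.volume_ne_zero Q.volume_ne_top, one_mul]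

/-- The coefficient 1 of the larger average is the point: only the oscillation pays for the change
of volume, so the bound can be iterated through dyadic generations. -/
theorem eavg_le_eavg_add_eosc {u : EuclideanSpace ℝ (Fin n) → ℝ}
    (hu : LocallyIntegrable u volume) {Q Q' : Cube n}
    (h : Q.toSet ⊆ Q'.toSet) {c : ℝ≥0∞} (hc : volume Q'.toSet ≤ c * volume Q.toSet) :
    eavg u Q ≤ eavg u Q' + c * eosc u Q' := by
  rw [add_comm]
  calc eavg u Q ≤ eavg (fun x => u x - avg u Q') Q + eavg (fun _ => avg u Q') Q := by
        refine eavg_add_le ((aemeasurable_cube hu Q).sub_const _) fun x _ => ?_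
        simpa using enorm_add_le (u x - avg u Q') (avg u Q')
    _ ≤ _ := by
        rw [eavg_const, eosc_eq hu]
        exact add_le_add (eavg_le_of_subset _ h hc) (enorm_avg_le u Q')

theorem enorm_avg_sub_avg_le {u : EuclideanSpace ℝ (Fin n) → ℝ}
    (hu : LocallyIntegrable u volume) {Q Q' : Cube n}
    (h : Q.toSet ⊆ Q'.toSet) {c : ℝ≥0∞} (hc : volume Q'.toSet ≤ c * volume Q.toSet) :
    ‖avg u Q - avg u Q'‖ₑ ≤ c * eosc u Q' := by
  rw [← avg_sub_const hu, eosc_eq hu]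
  exact (enorm_avg_le _ _).trans (eavg_le_of_subset _ h hc)

/-! ### The seminorm -/

theorem oscSum_le_jnNorm_rpow {p : ℝ} (hp : 0 < p) (f : EuclideanSpace ℝ (Fin n) → ℝ)
    {𝒬 : Set (Cube n)} (hc : 𝒬.Countable) (hd : 𝒬.PairwiseDisjoint Cube.toSet) :
    oscSum p f 𝒬 ≤ jnNorm p f ^ p :=
  (jnNorm_le_iff hp f _).1 le_rfl 𝒬 hc hd

theorem add_rpow_le_two_rpow_mul {p : ℝ} (hp : 1 ≤ p) (a b : ℝ≥0∞) :
    (a + b) ^ p ≤ 2 ^ (p - 1) * (a ^ p + b ^ p) := by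
  rw [mul_add]
  exact (ENNReal.rpow_add_le_mul_rpow_add_rpow a b hp).trans_eq (by ring)

/-- Convexity of t ^ p on each cube replaces Minkowski's inequality; the extra factor 2 is harmless
for closures. -/
theorem jnNorm_add_le {p : ℝ} (hp : 1 ≤ p) {f g : EuclideanSpace ℝ (Fin n) → ℝ}
    (hf : LocallyIntegrable f volume) (hg : LocallyIntegrable g volume) :
    jnNorm p (f + g) ≤ 2 * (jnNorm p f + jnNorm p g) := by
  have hp0 : 0 < p := by linarith
  rw [jnNorm_le_iff hp0]
  intro 𝒬 hc hd
  calc oscSum p (f + g) 𝒬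
      ≤ ∑' Q : 𝒬, 2 ^ (p - 1) * (volume (Q : Cube n).toSet * eosc f Q ^ p +
          volume (Q : Cube n).toSet * eosc g Q ^ p) := by
        rw [oscSum_eq]
        refine ENNReal.tsum_le_tsum fun Q => ?_
        rw [← mul_add, mul_left_comm]
        gcongr
        refine le_trans ?_ (add_rpow_le_two_rpow_mul hp _ _)
        gcongr
        exact eosc_add_le hf hg _
    _ = 2 ^ (p - 1) * (oscSum p f 𝒬 + oscSum p g 𝒬) := by
        rw [ENNReal.tsum_mul_left, ENNReal.tsum_add, oscSum_eq, oscSum_eq]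
    _ ≤ 2 ^ p * (jnNorm p f ^ p + jnNorm p g ^ p) := by
        gcongr
        · norm_num
        · linarith
        · exact oscSum_le_jnNorm_rpow hp0 f hc hd
        · exact oscSum_le_jnNorm_rpow hp0 g hc hd
    _ ≤ 2 ^ p * (jnNorm p f + jnNorm p g) ^ p := by
        gcongr
        exact ENNReal.add_rpow_le_rpow_add _ _ hp
    _ = _ := by rw [ENNReal.mul_rpow_of_nonneg _ _ hp0.le]

theorem jnNorm_neg {p : ℝ} {f : EuclideanSpace ℝ (Fin n) → ℝ}
    (hf : LocallyIntegrable f volume) : jnNorm p (-f) = jnNorm p f := by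
  have : ∀ 𝒬 : Set (Cube n), oscSum p (-f) 𝒬 = oscSum p f 𝒬 := fun 𝒬 => by
    simp only [oscSum_eq, eosc_neg hf]
  simp only [jnNorm, this]

theorem tsum_eq_oscSum {ι : Type*} (p : ℝ) (f : EuclideanSpace ℝ (Fin n) → ℝ) {c : ι → Cube n}
    (hd : Pairwise fun i j => Disjoint (c i).toSet (c j).toSet) :
    ∑' i, volume (c i).toSet * eosc f (c i) ^ p = oscSum p f (range c) := by
  have hinj : Function.Injective c := by
    intro i j hij
    by_contra hne
    have : Disjoint (c i).toSet (c j).toSet := hd hne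
    rw [hij, disjoint_self] at this
    exact (c j).nonempty.ne_empty this
  rw [oscSum_eq, tsum_range (fun Q : Cube n => volume Q.toSet * eosc f Q ^ p) hinj]

theorem pairwiseDisjoint_range {ι : Type*} {c : ι → Cube n}
    (hd : Pairwise fun i j => Disjoint (c i).toSet (c j).toSet) :
    (range c).PairwiseDisjoint Cube.toSet := by
  rintro _ ⟨i, rfl⟩ _ ⟨j, rfl⟩ hne
  exact hd fun h => hne (congrArg c h)

/-- The oscillation sums over cubes avoiding a large box are uniformly small. -/
theorem exists_box_oscSum_le {p : ℝ} (hp : 0 < p) {f : EuclideanSpace ℝ (Fin n) → ℝ}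
    (hf : jnNorm p f < ⊤) {ε : ℝ≥0∞} (hε : ε ≠ 0) :
    ∃ R : ℝ, ∀ 𝒬 : Set (Cube n), 𝒬.Countable → 𝒬.PairwiseDisjoint Cube.toSet →
      (∀ Q ∈ 𝒬, Disjoint Q.toSet (box n R)) → oscSum p f 𝒬 ≤ ε := by
  set S : ℝ≥0∞ := ⨆ (𝒬 : Set (Cube n)) (_ : 𝒬.Countable) (_ : 𝒬.PairwiseDisjoint Cube.toSet),
    oscSum p f 𝒬 with hS
  have hle : ∀ 𝒬 : Set (Cube n), 𝒬.Countable → 𝒬.PairwiseDisjoint Cube.toSet →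
      oscSum p f 𝒬 ≤ S := fun 𝒬 h1 h2 => le_iSup₂_of_le 𝒬 h1 (le_iSup_of_le h2 le_rfl)
  have hST : S ≠ ⊤ := by
    intro h
    rw [jnNorm, ← hS, h, ENNReal.top_rpow_of_pos (by positivity)] at hf
    exact lt_irrefl _ hf
  rcases le_or_gt S ε with h | h
  · exact ⟨0, fun 𝒬 h1 h2 _ => (hle 𝒬 h1 h2).trans h⟩
  -- A finite family nearly attaining the supremum lies in a bounded box. A family outside that box
  -- can be adjoined to it, so its sum cannot exceed ε.
  have h1 : S - ε < S := ENNReal.sub_lt_self hST (ne_bot_of_gt h) hε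
  obtain ⟨𝒬₀, h2⟩ := lt_iSup_iff.1 (hS ▸ h1)
  obtain ⟨hc₀, h2⟩ := lt_iSup_iff.1 h2
  obtain ⟨hd₀, h2⟩ := lt_iSup_iff.1 h2
  rw [oscSum_eq, ENNReal.tsum_eq_iSup_sum] at h2
  obtain ⟨s, hs⟩ := lt_iSup_iff.1 h2
  let F : Set (Cube n) := Subtype.val '' (s : Set 𝒬₀)
  have hF₀ : F ⊆ 𝒬₀ := by rintro _ ⟨Q, _, rfl⟩; exact Q.2
  have hsF : S - ε ≤ oscSum p f F := by
    have : oscSum p f F = ∑ Q ∈ s, volume (Q : Cube n).toSet * eosc f Q ^ p := by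
      rw [oscSum_eq, tsum_image (fun Q : Cube n => volume Q.toSet * eosc f Q ^ p)
        (Subtype.val_injective.injOn)]
      exact Finset.tsum_subtype s fun Q : 𝒬₀ => volume (Q : Cube n).toSet * eosc f Q ^ p
    rw [this]
    exact hs.le
  choose ρ hρ using fun Q : Cube n => Q.exists_subset_box
  obtain ⟨R, hR⟩ : ∃ R, ∀ Q ∈ F, ρ Q ≤ R := by
    obtain ⟨R, hR⟩ := ((s.finite_toSet.image Subtype.val).image ρ).bddAbove
    exact ⟨R, fun Q hQ => hR ⟨Q, hQ, rfl⟩⟩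
  have hFR : ∀ Q ∈ F, Q.toSet ⊆ box n R := fun Q hQ => (hρ Q).trans (box_mono (hR Q hQ))
  refine ⟨R, fun 𝒬 hc hd hQR => ?_⟩
  have hcross : ∀ Q ∈ 𝒬, ∀ Q' ∈ F, Disjoint Q.toSet Q'.toSet := fun Q hQ Q' hQ' =>
    (hQR Q hQ).mono_right (hFR Q' hQ')
  have hdisj : Disjoint 𝒬 F := by
    rw [Set.disjoint_left]
    intro Q hQ hQ'
    have := hcross Q hQ Q hQ'
    rw [disjoint_self] at this
    exact Q.nonempty.ne_empty this
  have hunion : oscSum p f (𝒬 ∪ F) = oscSum p f 𝒬 + oscSum p f F :=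
    Summable.tsum_union_disjoint (f := fun Q : Cube n => volume Q.toSet * eosc f Q ^ p) hdisj
      ENNReal.summable ENNReal.summable
  have h3 : oscSum p f (𝒬 ∪ F) ≤ S := by
    refine hle _ (hc.union (hc₀.mono hF₀)) ?_
    refine (pairwiseDisjoint_union).2 ⟨hd, hd₀.subset hF₀, fun Q hQ Q' hQ' _ => hcross Q hQ Q' hQ'⟩
  have h4 : oscSum p f 𝒬 + (S - ε) ≤ ε + (S - ε) := by
    calc oscSum p f 𝒬 + (S - ε) ≤ oscSum p f 𝒬 + oscSum p f F := by gcongr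
      _ ≤ S := hunion ▸ h3
      _ = ε + (S - ε) := by rw [add_tsub_cancel_of_le h.le]
  exact (ENNReal.add_le_add_iff_right (ne_top_of_le_ne_top hST tsub_le_self)).1 h4

/-! ### The inclusion of `CJN` in `VJN` -/

theorem smoothCompact_subset_smoothGradLp (n : ℕ) (p : ℝ) :
    smoothCompact n ⊆ smoothGradLp n p := by
  rintro f ⟨hf, hc⟩
  refine ⟨hf, ?_⟩
  have h1 : Continuous (gradient f) :=
    (LinearIsometryEquiv.continuous _).comp (hf.continuous_fderiv (by simp))
  have h2 : HasCompactSupport (fun x => ‖gradient f x‖) := by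
    have h3 : HasCompactSupport (gradient f) :=
      (hc.fderiv ℝ).comp_left (g := (InnerProductSpace.toDual ℝ _).symm) (map_zero _)
    exact h3.norm
  exact h1.norm.memLp_of_hasCompactSupport h2

theorem CJN_subset_VJN {p : ℝ} (hp : 1 < p) : CJN n p ⊆ VJN n p := by
  rintro f ⟨hf, happ⟩
  refine ⟨hf, fun ε hε => ?_⟩
  -- Distance below 1 makes the seminorm of g = f - (f - g) finite, so g is in JN_p without a
  -- separate estimate.
  obtain ⟨g, hg, hgε⟩ := happ (min ε 1) (lt_min hε one_pos)
  have hgl : LocallyIntegrable g volume := hg.1.continuous.locallyIntegrable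
  refine ⟨g, ⟨smoothCompact_subset_smoothGradLp n p hg, hgl, ?_⟩, hgε.trans_le (min_le_left _ _)⟩
  have h1 : g = f + -(f - g) := by abel
  rw [h1]
  refine (jnNorm_add_le hp.le hf.1 (hf.1.sub hgl).neg).trans_lt ?_
  rw [jnNorm_neg (hf.1.sub hgl)]
  exact ENNReal.mul_lt_top (by simp) (ENNReal.add_lt_top.2
    ⟨hf.2, (hgε.trans_le (min_le_right _ _)).trans ENNReal.one_lt_top⟩)

/-! ### Decay of averages over large centred cubes -/

open Filter Topology

/-- The Morrey type quantity `|Q| (⨍_Q |u|)^p`. -/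
def morrey (p : ℝ) (u : EuclideanSpace ℝ (Fin n) → ℝ) (Q : Cube n) : ℝ≥0∞ :=
  volume Q.toSet * eavg u Q ^ p

theorem morrey_le_of_subset {p : ℝ} (hp : 0 ≤ p) (u : EuclideanSpace ℝ (Fin n) → ℝ)
    {Q Q' : Cube n} (h : Q.toSet ⊆ Q'.toSet) {c : ℝ≥0∞}
    (hc : volume Q'.toSet ≤ c * volume Q.toSet) :
    morrey p u Q ≤ c ^ p * morrey p u Q' := by
  unfold morrey
  calc volume Q.toSet * eavg u Q ^ p ≤ volume Q'.toSet * (c * eavg u Q') ^ p := by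
        gcongr
        exact eavg_le_of_subset u h hc
    _ = _ := by rw [ENNReal.mul_rpow_of_nonneg _ _ hp]; ring

theorem tendsto_zero_of_le_mul_add {x : ℕ → ℝ} (hx : ∀ k, 0 ≤ x k) {θ : ℝ} (hθ₀ : 0 ≤ θ)
    (hθ : θ < 1) (h : ∀ ε > 0, ∃ k₀, ∀ k ≥ k₀, x (k + 1) ≤ θ * x k + ε) :
    Tendsto x atTop (𝓝 0) := by
  rw [Metric.tendsto_atTop]
  intro ε hε
  -- With this error, ε / 2 is the fixed point of the affine recursion.
  obtain ⟨k₀, hk₀⟩ := h (ε / 2 * (1 - θ)) (mul_pos (by positivity) (by linarith))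
  have h1 : ∀ j, x (k₀ + j) ≤ θ ^ j * x k₀ + ε / 2 := by
    intro j
    induction j with
    | zero => simp; linarith
    | succ j ih =>
      have := hk₀ (k₀ + j) (by omega)
      calc x (k₀ + (j + 1)) ≤ θ * x (k₀ + j) + ε / 2 * (1 - θ) := this
        _ ≤ θ * (θ ^ j * x k₀ + ε / 2) + ε / 2 * (1 - θ) := by gcongr
        _ = _ := by ring
  have h2 : Tendsto (fun j => θ ^ j * x k₀) atTop (𝓝 (0 * x k₀)) :=
    (tendsto_pow_atTop_nhds_zero_of_lt_one hθ₀ hθ).mul_const _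
  rw [zero_mul] at h2
  obtain ⟨j₀, hj₀⟩ := (h2.eventually (gt_mem_nhds (half_pos hε))).exists_forall_of_atTop
  refine ⟨k₀ + j₀, fun k hk => ?_⟩
  obtain ⟨j, rfl⟩ := Nat.exists_eq_add_of_le (show k₀ ≤ k by omega)
  have := h1 j
  have := hj₀ j (by omega)
  rw [Real.dist_0_eq_abs, abs_of_nonneg (hx _)]
  linarith

/-- The factor `2 ^ (-n / p)` by which `|Q| ^ (-1 / p)` changes when `Q` is doubled. -/
def decayRate (n : ℕ) (p : ℝ) : ℝ := 2 ^ (-(n : ℝ) / p)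

theorem decayRate_pos (n : ℕ) (p : ℝ) : 0 < decayRate n p := Real.rpow_pos_of_pos two_pos _

theorem decayRate_lt_one (hn : 1 ≤ n) {p : ℝ} (hp : 1 < p) : decayRate n p < 1 := by
  have hn' : (0 : ℝ) < n := by exact_mod_cast hn
  refine Real.rpow_lt_one_of_one_lt_of_neg one_lt_two (div_neg_of_neg_of_pos ?_ ?_) <;> linarith

/-- The contraction in the decay argument rests on this inequality, which amounts to n / p < n. -/
theorem two_pow_inv_lt_decayRate (hn : 1 ≤ n) {p : ℝ} (hp : 1 < p) :
    ((2 : ℝ) ^ n)⁻¹ < decayRate n p := by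
  have hn' : (0 : ℝ) < n := by exact_mod_cast hn
  rw [← Real.rpow_natCast, ← Real.rpow_neg two_pos.le]
  refine Real.rpow_lt_rpow_of_exponent_lt one_lt_two ?_
  rw [neg_div, neg_lt_neg_iff]
  exact div_lt_self hn' hp

theorem decayRate_pow_rpow (n : ℕ) {p : ℝ} (hp : 0 < p) (k : ℕ) :
    ENNReal.ofReal (decayRate n p ^ k) ^ p * ENNReal.ofReal (2 ^ k) ^ n = 1 := by
  have h0 := decayRate_pos n p
  rw [ENNReal.ofReal_rpow_of_pos (by positivity), ← ENNReal.ofReal_pow (by positivity),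
    ← ENNReal.ofReal_mul (by positivity), ← ENNReal.ofReal_one]
  congr 1
  rw [← Real.rpow_natCast, decayRate, ← Real.rpow_mul (by positivity), ← Real.rpow_mul (by positivity),
    ← pow_mul, ← Real.rpow_natCast, ← Real.rpow_add two_pos]
  convert Real.rpow_zero 2 using 2
  push_cast
  field_simp
  ring

theorem meanOsc_nonneg (f : EuclideanSpace ℝ (Fin n) → ℝ) (Q : Cube n) : 0 ≤ meanOsc f Q := by
  unfold meanOsc
  rw [setAverage_eq]
  exact mul_nonneg (by positivity) (integral_nonneg fun x => abs_nonneg _)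

/-- A single cube is an admissible family, and its volume is at least 2 ^ (k n), which is exactly
what `decayRate` compensates. -/
theorem meanOsc_le_of_oscSum {p : ℝ} (hp : 0 < p) {f : EuclideanSpace ℝ (Fin n) → ℝ} {Q : Cube n}
    {k : ℕ} (hk : 2 ^ k ≤ Q.side) {δ : ℝ} (hδ : 0 ≤ δ)
    (h : oscSum p f {Q} ≤ ENNReal.ofReal δ ^ p) : meanOsc f Q ≤ δ * decayRate n p ^ k := by
  have h0 := decayRate_pos n p
  rw [oscSum_eq, tsum_singleton Q (fun Q : Cube n => volume Q.toSet * eosc f Q ^ p),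
    Q.volume_toSet] at h
  rw [← ENNReal.ofReal_le_ofReal_iff (by positivity), ENNReal.ofReal_mul hδ,
    ← ENNReal.rpow_le_rpow_iff hp, ENNReal.mul_rpow_of_nonneg _ _ hp.le]
  calc eosc f Q ^ p
      = ENNReal.ofReal (decayRate n p ^ k) ^ p * (ENNReal.ofReal (2 ^ k) ^ n * eosc f Q ^ p) := by
        rw [← mul_assoc, decayRate_pow_rpow n hp, one_mul]
    _ ≤ ENNReal.ofReal (decayRate n p ^ k) ^ p * (ENNReal.ofReal Q.side ^ n * eosc f Q ^ p) := by
        gcongr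
    _ ≤ ENNReal.ofReal (decayRate n p ^ k) ^ p * ENNReal.ofReal δ ^ p := by gcongr
    _ = _ := mul_comm _ _

theorem abs_avg_sub_avg_le {f : EuclideanSpace ℝ (Fin n) → ℝ} (hf : LocallyIntegrable f volume)
    {Q Q' : Cube n} (h : Q.toSet ⊆ Q'.toSet) {c : ℝ} (hc₀ : 0 ≤ c) (hc : Q'.side ≤ c * Q.side) :
    |avg f Q - avg f Q'| ≤ c ^ n * meanOsc f Q' := by
  have h1 := enorm_avg_sub_avg_le hf h (Cube.volume_le_of_subset c hc₀ hc)
  rw [Real.enorm_eq_ofReal_abs, eosc, ← ENNReal.ofReal_pow hc₀, ← ENNReal.ofReal_mul (by positivity),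
    ENNReal.ofReal_le_ofReal_iff (mul_nonneg (by positivity) (meanOsc_nonneg _ _))] at h1
  exact h1

theorem abs_sub_lim_le {a : ℕ → ℝ} {b C r : ℝ} (hr : r < 1)
    (ha : Tendsto a atTop (𝓝 b)) {k₀ : ℕ} (h : ∀ k ≥ k₀, |a k - a (k + 1)| ≤ C * r ^ k)
    {k : ℕ} (hk : k₀ ≤ k) : |a k - b| ≤ C * r ^ k / (1 - r) := by
  have h1 := dist_le_of_le_geometric_of_tendsto (f := fun j => a (k + j)) r (C * r ^ k) hr
    (fun j => by
      rw [Real.dist_eq, mul_assoc, ← pow_add]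
      exact h (k + j) (by omega))
    ((tendsto_add_atTop_iff_nat k).2 ha |>.congr fun j => by rw [add_comm]) 0
  simpa [Real.dist_eq] using h1

/-- The centred cubes `(-2 ^ k, 2 ^ k)ⁿ`. -/
def dyadicCentred (n k : ℕ) : Cube n := centredCube n (2 ^ k) (by positivity)

/-- The cube of side `8 * 2 ^ k` given by `2 ^ k < ± x i < 9 * 2 ^ k` and `|x j| < 4 * 2 ^ k`
for `j ≠ i`. -/
def outerCube (i : Fin n) (σ : Bool) (k : ℕ) : Cube n where
  corner := WithLp.toLp 2 fun j =>
    if j = i then (if σ then 2 ^ k else -9 * 2 ^ k) else -4 * 2 ^ k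
  side := 8 * 2 ^ k
  side_pos := by positivity

/-- A cube of side `4 * 2 ^ k` in the intersection of two consecutive outer cubes. -/
def linkCube (i : Fin n) (σ : Bool) (k : ℕ) : Cube n where
  corner := WithLp.toLp 2 fun j =>
    if j = i then (if σ then 2 * 2 ^ k else -6 * 2 ^ k) else -4 * 2 ^ k
  side := 4 * 2 ^ k
  side_pos := by positivity

theorem linkCube_subset_outerCube (i : Fin n) (σ : Bool) (k : ℕ) :
    (linkCube i σ k).toSet ⊆ (outerCube i σ k).toSet := by
  intro x hx j
  have h := hx j
  have h2 : (0 : ℝ) < 2 ^ k := by positivity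
  simp only [linkCube, outerCube, mem_Ioo] at h ⊢
  split_ifs at h ⊢ <;> constructor <;> linarith [h.1, h.2]

theorem linkCube_subset_outerCube_succ (i : Fin n) (σ : Bool) (k : ℕ) :
    (linkCube i σ k).toSet ⊆ (outerCube i σ (k + 1)).toSet := by
  intro x hx j
  have h := hx j
  have h2 : (0 : ℝ) < 2 ^ k := by positivity
  simp only [linkCube, outerCube, mem_Ioo, pow_succ] at h ⊢
  split_ifs at h ⊢ <;> constructor <;> linarith [h.1, h.2]

theorem outerCube_subset_dyadicCentred (i : Fin n) (σ : Bool) (k : ℕ) :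
    (outerCube i σ k).toSet ⊆ (dyadicCentred n (k + 4)).toSet := by
  intro x hx j
  have h := hx j
  have h2 : (0 : ℝ) < 2 ^ k := by positivity
  simp only [dyadicCentred, centredCube, outerCube, mem_Ioo, pow_add] at h ⊢
  split_ifs at h <;> constructor <;> linarith [h.1, h.2]

theorem outerCube_disjoint_box (i : Fin n) (σ : Bool) (k : ℕ) :
    Disjoint (outerCube i σ k).toSet (box n (2 ^ k)) := by
  rw [Set.disjoint_left]
  intro x hx hx'
  have h := hx i
  have h' := abs_lt.1 (hx' i)
  have h2 : (0 : ℝ) < 2 ^ k := by positivity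
  simp only [outerCube, mem_Ioo, if_true] at h
  split_ifs at h <;> linarith [h.1, h.2, h'.1, h'.2]

/-- A point outside the core has a coordinate with 2 * 2 ^ k ≤ ± x i < 4 * 2 ^ k; its index and sign
select the outer cube. -/
theorem dyadicCentred_subset (n k : ℕ) : (dyadicCentred n (k + 2)).toSet ⊆
    (dyadicCentred n (k + 1)).toSet ∪ ⋃ s : Fin n × Bool, (outerCube s.1 s.2 k).toSet := by
  intro x hx
  simp only [dyadicCentred, centredCube_toSet] at hx ⊢
  by_cases h : x ∈ box n (2 ^ (k + 1))
  · exact Or.inl h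
  right
  have h2 : (0 : ℝ) < 2 ^ k := by positivity
  simp only [box, mem_ofPred_eq, not_forall, not_lt, pow_add] at h hx
  simp only [abs_lt] at hx
  obtain ⟨i, hi⟩ := h
  rw [mem_iUnion]
  rcases le_abs.1 hi with h3 | h3
  · refine ⟨(i, true), fun j => ?_⟩
    have := hx j
    simp only [outerCube, mem_Ioo, if_true]
    split_ifs with hj
    · subst hj; constructor <;> linarith [this.1, this.2]
    · constructor <;> linarith [this.1, this.2]
  · refine ⟨(i, false), fun j => ?_⟩
    have := hx j
    simp only [outerCube, mem_Ioo, Bool.false_eq_true, if_false]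
    split_ifs with hj
    · subst hj; constructor <;> linarith [this.1, this.2]
    · constructor <;> linarith [this.1, this.2]

/-- The outer cubes have the same side 8 * 2 ^ k as the large centred cube, so their averages appear
without loss, while the core carries the fraction 2 ^ (-n) of the volume. -/
theorem eavg_dyadicCentred_le (u : EuclideanSpace ℝ (Fin n) → ℝ) (k : ℕ) :
    eavg u (dyadicCentred n (k + 2)) ≤ (2 ^ n)⁻¹ * eavg u (dyadicCentred n (k + 1)) +
      ∑ s : Fin n × Bool, eavg u (outerCube s.1 s.2 k) := by
  have h1 : ∫⁻ x in (dyadicCentred n (k + 2)).toSet, ‖u x‖ₑ ≤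
      (∫⁻ x in (dyadicCentred n (k + 1)).toSet, ‖u x‖ₑ) +
      ∑ s : Fin n × Bool, ∫⁻ x in (outerCube s.1 s.2 k).toSet, ‖u x‖ₑ := by
    refine (lintegral_mono_set (dyadicCentred_subset n k)).trans
      ((lintegral_union_le _ _ _).trans ?_)
    gcongr
    exact (lintegral_iUnion_le _ _).trans_eq (tsum_fintype _)
  have h2 : ∀ s : Fin n × Bool, volume (outerCube s.1 s.2 k).toSet =
      volume (dyadicCentred n (k + 2)).toSet := by
    intro s
    rw [Cube.volume_toSet, Cube.volume_toSet]
    simp only [outerCube, dyadicCentred, centredCube]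
    congr 2
    ring
  have h3 : volume (dyadicCentred n (k + 2)).toSet =
      2 ^ n * volume (dyadicCentred n (k + 1)).toSet := by
    rw [Cube.volume_toSet, Cube.volume_toSet, ← mul_pow]
    congr 1
    rw [show (2 : ℝ≥0∞) = ENNReal.ofReal 2 by simp, ← ENNReal.ofReal_mul (by norm_num)]
    simp only [dyadicCentred, centredCube]
    congr 1
    ring
  unfold eavg
  simp only [h2]
  rw [← Finset.mul_sum, ← mul_assoc, ← ENNReal.mul_inv (by simp) (by simp), ← h3, ← mul_add]
  gcongr

/-- Subtracting a suitable constant, the averages over large centred cubes of a function in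
`JN_p` decay faster than `|Q| ^ (-1 / p)`. -/
theorem exists_morrey_dyadicCentred_tendsto (hn : 1 ≤ n) {p : ℝ} (hp : 1 < p)
    {f : EuclideanSpace ℝ (Fin n) → ℝ} (hf : f ∈ JN n p) :
    ∃ b : ℝ, Tendsto (fun k => (eavg (fun x => f x - b) (dyadicCentred n k)).toReal /
      decayRate n p ^ k) atTop (𝓝 0) := by
  obtain ⟨hfl, hfn⟩ := hf
  have hp0 : 0 < p := by linarith
  set r := decayRate n p with hr
  have hr0 : 0 < r := decayRate_pos n p
  have hr1 : r < 1 := decayRate_lt_one hn hp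
  have hsing : ∀ Q : Cube n, ({Q} : Set (Cube n)).PairwiseDisjoint Cube.toSet :=
    fun Q => pairwiseDisjoint_singleton Q _
  obtain ⟨K, hK0, hK⟩ : ∃ K : ℝ, 0 ≤ K ∧ ∀ (Q : Cube n) (k : ℕ), 2 ^ k ≤ Q.side →
      meanOsc f Q ≤ K * r ^ k := by
    refine ⟨(jnNorm p f).toReal, ENNReal.toReal_nonneg, fun Q k hk =>
      meanOsc_le_of_oscSum hp0 hk ENNReal.toReal_nonneg ?_⟩
    rw [ENNReal.ofReal_toReal hfn.ne]
    exact oscSum_le_jnNorm_rpow hp0 f (countable_singleton Q) (hsing Q)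
  -- Outer cubes escape every box, so the tail estimate improves the constant K to an arbitrarily
  -- small δ.
  have hsmall : ∀ δ > 0, ∃ k₀ : ℕ, ∀ k ≥ k₀, ∀ s : Fin n × Bool,
      meanOsc f (outerCube s.1 s.2 k) ≤ δ * r ^ k := by
    intro δ hδ
    obtain ⟨R, hR⟩ := exists_box_oscSum_le hp0 hfn (ε := ENNReal.ofReal δ ^ p) (by
      rw [Ne, ENNReal.rpow_eq_zero_iff_of_pos hp0]
      simpa using hδ)
    obtain ⟨k₀, hk₀⟩ := pow_unbounded_of_one_lt R one_lt_two
    refine ⟨k₀, fun k hk s => meanOsc_le_of_oscSum hp0 ?_ hδ.le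
      (hR _ (countable_singleton _) (hsing _) fun Q hQ => ?_)⟩
    · have : (0 : ℝ) < 2 ^ k := by positivity
      simp only [outerCube]
      linarith
    · rw [mem_singleton_iff] at hQ
      rw [hQ]
      refine (outerCube_disjoint_box s.1 s.2 k).mono_right (box_mono (hk₀.le.trans ?_))
      exact pow_le_pow_right₀ one_le_two hk
  -- The centred averages have geometrically small increments, hence a limit; this limit is the
  -- constant b.
  have hc : ∀ k, |avg f (dyadicCentred n k) - avg f (dyadicCentred n (k + 1))| ≤
      2 ^ n * K * r ^ k := by
    intro k
    have h2 : (0 : ℝ) < 2 ^ k := by positivity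
    refine (abs_avg_sub_avg_le hfl (Q := dyadicCentred n k) (Q' := dyadicCentred n (k + 1))
      ?_ (c := 2) (by norm_num) ?_).trans ?_
    · simp only [dyadicCentred, centredCube_toSet]
      exact box_mono (by rw [pow_succ]; linarith)
    · simp only [dyadicCentred, centredCube]
      exact (by ring : (2 : ℝ) * 2 ^ (k + 1) = 2 * (2 * 2 ^ k)).le
    · rw [mul_assoc]
      gcongr
      apply hK
      simp only [dyadicCentred, centredCube, pow_succ]
      linarith
  obtain ⟨b, hb⟩ : ∃ b, Tendsto (fun k => avg f (dyadicCentred n k)) atTop (𝓝 b) :=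
    cauchySeq_tendsto_of_complete (cauchySeq_of_le_geometric r _ hr1 hc)
  refine ⟨b, ?_⟩
  -- The outer averages share the limit b: an outer cube lies in a centred cube of four times its
  -- side, whose oscillation tends to 0.
  have hD : ∀ s : Fin n × Bool, Tendsto (fun k => avg f (outerCube s.1 s.2 k)) atTop (𝓝 b) := by
    intro s
    have h1 : Tendsto (fun k => avg f (outerCube s.1 s.2 k) - avg f (dyadicCentred n (k + 4)))
        atTop (𝓝 0) := by
      have h2 : Tendsto (fun k => 4 ^ n * (K * r ^ k)) atTop (𝓝 (4 ^ n * (K * 0))) :=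
        ((tendsto_pow_atTop_nhds_zero_of_lt_one hr0.le hr1).const_mul K).const_mul _
      rw [mul_zero, mul_zero] at h2
      refine squeeze_zero_norm (fun k => ?_) h2
      rw [Real.norm_eq_abs]
      have h2 : (0 : ℝ) < 2 ^ k := by positivity
      refine (abs_avg_sub_avg_le hfl (outerCube_subset_dyadicCentred s.1 s.2 k) (c := 4)
        (by norm_num) ?_).trans ?_
      · simp only [dyadicCentred, centredCube, outerCube]
        exact (by ring : (2 : ℝ) * 2 ^ (k + 4) = 4 * (8 * 2 ^ k)).le
      · gcongr
        apply hK
        simp only [dyadicCentred, centredCube, pow_add]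
        linarith
    have h3 := h1.add ((tendsto_add_atTop_iff_nat 4).2 hb)
    simpa using h3
  set C : ℝ := 1 + 4 ^ n * 2 / (1 - r) with hC
  have hC0 : 0 < C := by
    have : 0 < 1 - r := by linarith
    positivity
  have hz : ∀ δ > 0, ∃ k₀ : ℕ, ∀ k ≥ k₀, ∀ s : Fin n × Bool,
      eavg (fun x => f x - b) (outerCube s.1 s.2 k) ≤ ENNReal.ofReal (C * δ * r ^ k) := by
    intro δ hδ
    obtain ⟨k₀, hk₀⟩ := hsmall δ hδ
    refine ⟨k₀, fun k hk s => ?_⟩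
    -- Consecutive outer cubes are compared through their common link cube. The chain stays far from
    -- the origin, so the increments carry δ rather than K, and summing them bounds the distance to
    -- b.
    have hlink : ∀ k ≥ k₀, |avg f (outerCube s.1 s.2 k) - avg f (outerCube s.1 s.2 (k + 1))| ≤
        4 ^ n * 2 * δ * r ^ k := by
      intro k hk
      have h2 : (0 : ℝ) < 2 ^ k := by positivity
      have e1 := abs_avg_sub_avg_le hfl (linkCube_subset_outerCube s.1 s.2 k) (c := 4)
        (by norm_num) (by simp only [linkCube, outerCube]; linarith)
      have e2 := abs_avg_sub_avg_le hfl (linkCube_subset_outerCube_succ s.1 s.2 k) (c := 4)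
        (by norm_num) (by simp only [linkCube, outerCube, pow_succ]; linarith)
      have e3 := hk₀ k hk s
      have e4 := hk₀ (k + 1) (by omega) s
      have e5 : δ * r ^ (k + 1) ≤ δ * r ^ k := by
        gcongr ?_ * ?_
        exact pow_le_pow_of_le_one hr0.le hr1.le (by omega)
      calc |avg f (outerCube s.1 s.2 k) - avg f (outerCube s.1 s.2 (k + 1))|
          ≤ |avg f (linkCube s.1 s.2 k) - avg f (outerCube s.1 s.2 k)| +
            |avg f (linkCube s.1 s.2 k) - avg f (outerCube s.1 s.2 (k + 1))| := by
              rw [abs_sub_comm (avg f (linkCube s.1 s.2 k))]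
              exact abs_sub_le _ _ _
        _ ≤ 4 ^ n * (δ * r ^ k) + 4 ^ n * (δ * r ^ k) := by
              gcongr
              · exact e1.trans (by gcongr)
              · exact e2.trans (by gcongr; exact e4.trans e5)
        _ = _ := by ring
    have h1 := abs_sub_lim_le hr1 (hD s) hlink hk
    calc eavg (fun x => f x - b) (outerCube s.1 s.2 k)
        ≤ eavg (fun x => f x - avg f (outerCube s.1 s.2 k)) (outerCube s.1 s.2 k) +
          eavg (fun _ => avg f (outerCube s.1 s.2 k) - b) (outerCube s.1 s.2 k) := by
          refine eavg_add_le ((aemeasurable_cube hfl _).sub_const _) fun x _ => ?_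
          rw [← sub_add_sub_cancel (f x) (avg f (outerCube s.1 s.2 k)) b]
          exact enorm_add_le _ _
      _ ≤ ENNReal.ofReal (δ * r ^ k) + ENNReal.ofReal (4 ^ n * 2 * δ * r ^ k / (1 - r)) := by
          rw [← eosc_eq hfl, eavg_const, Real.enorm_eq_ofReal_abs]
          exact add_le_add (ENNReal.ofReal_le_ofReal (hk₀ k hk s)) (ENNReal.ofReal_le_ofReal h1)
      _ = _ := by
          have : 0 < 1 - r := by linarith
          rw [← ENNReal.ofReal_add (by positivity) (by positivity)]
          congr 1
          rw [hC]
          field_simp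
  have hul := locallyIntegrable_sub_const hfl b
  set y : ℕ → ℝ := fun k => (eavg (fun x => f x - b) (dyadicCentred n k)).toReal with hy
  have hθ : ((2 : ℝ) ^ n)⁻¹ / r < 1 := by
    rw [div_lt_one hr0]
    exact two_pow_inv_lt_decayRate hn hp
  rw [← tendsto_add_atTop_iff_nat 1]
  refine tendsto_zero_of_le_mul_add (fun k => by positivity) (by positivity) hθ fun ε hε => ?_
  have hn0 : (0 : ℝ) < n := by exact_mod_cast hn
  -- There are 2n outer cubes; this choice makes their total contribution ε r ^ (k + 2), that is ε
  -- after division by r ^ (k + 2).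
  obtain ⟨k₀, hk₀⟩ := hz (ε * r ^ 2 / (2 * n * C)) (by positivity)
  refine ⟨k₀, fun k hk => ?_⟩
  have h1 : y (k + 2) ≤ ((2 : ℝ) ^ n)⁻¹ * y (k + 1) + ε * r ^ 2 * r ^ k := by
    have h2 := eavg_dyadicCentred_le (fun x => f x - b) k
    have h3 : ∑ s : Fin n × Bool, eavg (fun x => f x - b) (outerCube s.1 s.2 k) ≤
        ENNReal.ofReal (ε * r ^ 2 * r ^ k) := by
      refine (Finset.sum_le_sum fun s _ => hk₀ k hk s).trans ?_
      rw [Finset.sum_const, nsmul_eq_mul, Finset.card_univ, Fintype.card_prod, Fintype.card_fin,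
        Fintype.card_bool, ← ENNReal.ofReal_natCast, ← ENNReal.ofReal_mul (by positivity)]
      refine ENNReal.ofReal_le_ofReal (le_of_eq ?_)
      push_cast
      field_simp
    have h4 : eavg (fun x => f x - b) (dyadicCentred n (k + 2)) ≤
        ENNReal.ofReal (((2 : ℝ) ^ n)⁻¹ * y (k + 1) + ε * r ^ 2 * r ^ k) := by
      refine (h2.trans (add_le_add_right h3 _)).trans_eq ?_
      simp only [hy]
      rw [ENNReal.ofReal_add (by positivity) (by positivity),
        ENNReal.ofReal_mul (p := ((2 : ℝ) ^ n)⁻¹) (by positivity), ENNReal.ofReal_toReal (eavg_ne_top hul _), ENNReal.ofReal_inv_of_pos (by positivity),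
        ENNReal.ofReal_pow (by norm_num), ENNReal.ofReal_ofNat]
    exact ENNReal.toReal_le_of_le_ofReal (by positivity) h4
  change y (k + 1 + 1) / r ^ (k + 1 + 1) ≤ _ * (y (k + 1) / r ^ (k + 1)) + ε
  rw [div_le_iff₀ (by positivity)]
  refine h1.trans_eq ?_
  field_simp
  ring

/-- A general centred cube is enclosed in the next dyadic one, of at most twice its side, at the
cost of the factor (2 ^ n) ^ p. -/
theorem exists_morrey_centredCube_le (hn : 1 ≤ n) {p : ℝ} (hp : 1 < p)
    {f : EuclideanSpace ℝ (Fin n) → ℝ} (hf : f ∈ JN n p) :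
    ∃ b : ℝ, ∀ ε : ℝ≥0∞, ε ≠ 0 → ∃ L₀ : ℝ, ∀ (R : ℝ) (hR : 0 < R), L₀ ≤ R →
      morrey p (fun x => f x - b) (centredCube n R hR) ≤ ε := by
  obtain ⟨b, hb⟩ := exists_morrey_dyadicCentred_tendsto hn hp hf
  refine ⟨b, fun ε hε => ?_⟩
  have hp0 : 0 < p := by linarith
  have hul := locallyIntegrable_sub_const hf.1 b
  set u : EuclideanSpace ℝ (Fin n) → ℝ := fun x => f x - b
  set r := decayRate n p with hr
  have hr0 : 0 < r := decayRate_pos n p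
  have h1 : ∀ k, morrey p u (dyadicCentred n k) =
      2 ^ n * ENNReal.ofReal ((eavg u (dyadicCentred n k)).toReal / r ^ k) ^ p := by
    intro k
    have h2 : eavg u (dyadicCentred n k) =
        ENNReal.ofReal ((eavg u (dyadicCentred n k)).toReal / r ^ k) * ENNReal.ofReal (r ^ k) := by
      rw [← ENNReal.ofReal_mul (by positivity), div_mul_cancel₀ _ (by positivity),
        ENNReal.ofReal_toReal (eavg_ne_top hul _)]
    have h3 : volume (dyadicCentred n k).toSet = 2 ^ n * ENNReal.ofReal (2 ^ k) ^ n := by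
      rw [Cube.volume_toSet, ← mul_pow]
      simp only [dyadicCentred, centredCube]
      rw [ENNReal.ofReal_mul (by norm_num), ENNReal.ofReal_ofNat]
    unfold morrey
    conv_lhs => rw [h2, h3, ENNReal.mul_rpow_of_nonneg _ _ hp0.le]
    calc _ = 2 ^ n * ENNReal.ofReal ((eavg u (dyadicCentred n k)).toReal / r ^ k) ^ p *
          (ENNReal.ofReal (r ^ k) ^ p * ENNReal.ofReal (2 ^ k) ^ n) := by ring
      _ = _ := by rw [decayRate_pow_rpow n hp0, mul_one]
  have h2 : Tendsto (fun k => ((2 : ℝ≥0∞) ^ n) ^ p * morrey p u (dyadicCentred n (k + 1))) atTop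
      (𝓝 (((2 : ℝ≥0∞) ^ n) ^ p * (2 ^ n * ENNReal.ofReal 0 ^ p))) := by
    simp only [h1]
    have h3 : Tendsto (fun k => ENNReal.ofReal
        ((eavg u (dyadicCentred n (k + 1))).toReal / r ^ (k + 1)) ^ p) atTop
        (𝓝 (ENNReal.ofReal 0 ^ p)) :=
      ((ENNReal.continuous_rpow_const.tendsto _).comp
        ((ENNReal.continuous_ofReal.tendsto _).comp ((tendsto_add_atTop_iff_nat 1).2 hb)))
    refine ENNReal.Tendsto.const_mul (ENNReal.Tendsto.const_mul h3 (Or.inr (by simp))) (Or.inr ?_)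
    exact ENNReal.rpow_ne_top_of_nonneg hp0.le (by simp)
  rw [ENNReal.ofReal_zero, ENNReal.zero_rpow_of_pos hp0, mul_zero, mul_zero] at h2
  obtain ⟨k₀, hk₀⟩ := (h2.eventually (gt_mem_nhds (pos_iff_ne_zero.2 hε))).exists_forall_of_atTop
  refine ⟨2 ^ k₀, fun R hR hRk => ?_⟩
  have h2k : (1 : ℝ) ≤ 2 ^ k₀ := one_le_pow₀ one_le_two
  obtain ⟨k, hk1, hk2⟩ := exists_nat_pow_near (h2k.trans hRk) one_lt_two
  have hkk : k₀ ≤ k := by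
    by_contra hlt
    have : (2 : ℝ) ^ (k + 1) ≤ 2 ^ k₀ := pow_le_pow_right₀ one_le_two (by omega)
    linarith
  refine le_trans (morrey_le_of_subset hp0.le u (Q' := dyadicCentred n (k + 1)) ?_ ?_)
    (hk₀ k hkk).le
  · simp only [dyadicCentred, centredCube_toSet]
    exact box_mono hk2.le
  · have := Cube.volume_le_of_subset (Q := centredCube n R hR) (Q' := dyadicCentred n (k + 1)) 2
      (by norm_num) (by
        simp only [dyadicCentred, centredCube]
        rw [pow_succ]
        linarith)
    simpa using this

/-! ### Packing small cubes into dyadic grids -/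

/-- The embedding of ℓ¹ in ℓᵖ: one factor of each a i ^ p is kept, and the remaining power p - 1 is
bounded by that of the whole sum. -/
theorem tsum_rpow_le_rpow_tsum {ι : Type*} (a : ι → ℝ≥0∞) {p : ℝ} (hp : 1 ≤ p) :
    ∑' i, a i ^ p ≤ (∑' i, a i) ^ p := by
  have h : ∀ x : ℝ≥0∞, x ^ p = x * x ^ (p - 1) := fun x => by
    conv_lhs => rw [show p = 1 + (p - 1) by ring]
    rw [ENNReal.rpow_add_of_nonneg _ _ zero_le_one (by linarith), ENNReal.rpow_one]
  calc ∑' i, a i ^ p ≤ ∑' i, a i * (∑' j, a j) ^ (p - 1) := by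
        refine ENNReal.tsum_le_tsum fun i => ?_
        rw [h (a i)]
        gcongr
        exact ENNReal.le_tsum i
    _ = _ := by rw [ENNReal.tsum_mul_right, ← h]

/-- Disjoint subcubes of comparable size: the Morrey quantities add up to at most that of the
containing cube. -/
theorem tsum_morrey_le {ι : Type*} [Countable ι] {p : ℝ} (hp : 1 ≤ p)
    (u : EuclideanSpace ℝ (Fin n) → ℝ) {c : ι → Cube n} {P : Cube n}
    (hd : Pairwise fun i j => Disjoint (c i).toSet (c j).toSet)
    (hP : ∀ i, (c i).toSet ⊆ P.toSet) {C : ℝ≥0∞}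
    (hC : ∀ i, volume P.toSet ≤ C * volume (c i).toSet) :
    ∑' i, morrey p u (c i) ≤ C ^ p * morrey p u P := by
  have hp0 : 0 ≤ p := by linarith
  have h1 : ∀ i, (volume (c i).toSet)⁻¹ ≤ C * (volume P.toSet)⁻¹ := fun i => by
    calc (volume (c i).toSet)⁻¹
        = (volume (c i).toSet)⁻¹ * (volume P.toSet * (volume P.toSet)⁻¹) := by
          rw [ENNReal.mul_inv_cancel P.volume_ne_zero P.volume_ne_top, mul_one]
      _ ≤ (volume (c i).toSet)⁻¹ * (C * volume (c i).toSet * (volume P.toSet)⁻¹) := by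
          gcongr
          exact hC i
      _ = (volume (c i).toSet)⁻¹ * volume (c i).toSet * (C * (volume P.toSet)⁻¹) := by ring
      _ = _ := by
          rw [ENNReal.inv_mul_cancel (c i).volume_ne_zero (c i).volume_ne_top, one_mul]
  calc ∑' i, morrey p u (c i)
      ≤ ∑' i, volume P.toSet *
          (C * (volume P.toSet)⁻¹ * ∫⁻ x in (c i).toSet, ‖u x‖ₑ) ^ p := by
        refine ENNReal.tsum_le_tsum fun i => ?_
        unfold morrey eavg
        gcongr
        · exact hP i
        · exact h1 i
    _ ≤ volume P.toSet * (C * (volume P.toSet)⁻¹ * ∑' i, ∫⁻ x in (c i).toSet, ‖u x‖ₑ) ^ p := by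
        rw [ENNReal.tsum_mul_left, ← ENNReal.tsum_mul_left (a := C * (volume P.toSet)⁻¹)]
        gcongr
        exact tsum_rpow_le_rpow_tsum _ hp
    _ ≤ volume P.toSet * (C * eavg u P) ^ p := by
        rw [eavg, ← mul_assoc]
        gcongr
        rw [← lintegral_iUnion (fun i => (c i).measurableSet) hd]
        exact lintegral_mono_set (iUnion_subset hP)
    _ = _ := by rw [ENNReal.mul_rpow_of_nonneg _ _ hp0, morrey]; ring

/-- The cube with lower corner `2⁻ᵏ s m` and side `2 * 2⁻ᵏ s`. -/
def gridCube {s : ℝ} (hs : 0 < s) (k : ℕ) (m : Fin n → ℤ) : Cube n where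
  corner := WithLp.toLp 2 fun i => s / 2 ^ k * m i
  side := 2 * (s / 2 ^ k)
  side_pos := by positivity

theorem gridCube_succ_subset {s : ℝ} (hs : 0 < s) (k : ℕ) (m : Fin n → ℤ) :
    (gridCube hs (k + 1) m).toSet ⊆ (gridCube hs k fun i => m i / 2).toSet := by
  intro x hx i
  have h := hx i
  simp only [gridCube, mem_Ioo, pow_succ] at h ⊢
  have h1 : 2 * (m i / 2) ≤ m i := by omega
  have h2 : m i ≤ 2 * (m i / 2) + 1 := by omega
  have h1' : 2 * ((m i / 2 : ℤ) : ℝ) ≤ m i := by exact_mod_cast h1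
  have h2' : (m i : ℝ) ≤ 2 * ((m i / 2 : ℤ) : ℝ) + 1 := by exact_mod_cast h2
  set t := s / (2 ^ k * 2) with ht
  have ht0 : 0 < t := by positivity
  have ht2 : s / 2 ^ k = 2 * t := by rw [ht]; field_simp
  rw [ht2]
  constructor <;> nlinarith [h.1, h.2]

theorem gridCube_subset_zero {s : ℝ} (hs : 0 < s) (k : ℕ) (m : Fin n → ℤ) :
    (gridCube hs k m).toSet ⊆ (gridCube hs 0 fun i => m i / 2 ^ k).toSet := by
  induction k generalizing m with
  | zero => simp
  | succ k ih =>
    refine (gridCube_succ_subset hs k m).trans ((ih _).trans_eq ?_)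
    congr 2 with i
    rw [pow_succ', Int.ediv_ediv_of_nonneg (by norm_num)]

theorem volume_gridCube {s : ℝ} (hs : 0 < s) (k : ℕ) (m : Fin n → ℤ) :
    volume (gridCube hs k m).toSet = ENNReal.ofReal (2 * (s / 2 ^ k)) ^ n :=
  Cube.volume_toSet _

theorem volume_gridCube_succ {s : ℝ} (hs : 0 < s) (k : ℕ) (m m' : Fin n → ℤ) :
    volume (gridCube hs k m').toSet = 2 ^ n * volume (gridCube hs (k + 1) m).toSet := by
  rw [volume_gridCube, volume_gridCube, ← mul_pow]
  congr 1
  rw [show (2 : ℝ≥0∞) = ENNReal.ofReal 2 by simp, ← ENNReal.ofReal_mul (by norm_num)]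
  congr 1
  field_simp
  ring

/-- The integer vectors with prescribed parities. -/
def ofParity (ρ : Fin n → Fin 2) (m : Fin n → ℤ) : Fin n → ℤ := fun i => 2 * m i + (ρ i : ℕ)

theorem ofParity_ediv (ρ : Fin n → Fin 2) (m : Fin n → ℤ) :
    (fun i => ofParity ρ m i / 2) = m := by
  funext i
  have := (ρ i).2
  unfold ofParity
  omega

/-- An integer vector is determined by its parities and its halves. -/
def parityEquiv (n : ℕ) : (Fin n → Fin 2) × (Fin n → ℤ) ≃ (Fin n → ℤ) where
  toFun q := ofParity q.1 q.2
  invFun m := (fun i => ⟨(m i % 2).toNat, by omega⟩, fun i => m i / 2)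
  left_inv := by
    rintro ⟨ρ, m⟩
    refine Prod.ext ?_ (ofParity_ediv ρ m)
    funext i
    ext
    have := (ρ i).2
    simp only [ofParity]
    omega
  right_inv := by
    intro m
    funext i
    simp only [ofParity]
    omega

theorem tsum_eq_sum_parity (F : (Fin n → ℤ) → ℝ≥0∞) :
    ∑' m, F m = ∑ ρ : Fin n → Fin 2, ∑' m, F (ofParity ρ m) := by
  rw [← (parityEquiv n).tsum_eq, ENNReal.tsum_prod', tsum_fintype]
  rfl

/-- Grid cubes overlap, their side being twice the grid spacing. Within one parity class the corners
are spaced by a full side, so the open cubes are disjoint. -/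
theorem gridCube_disjoint {s : ℝ} (hs : 0 < s) (k : ℕ) (ρ : Fin n → Fin 2) :
    Pairwise fun m m' => Disjoint (gridCube hs k (ofParity ρ m)).toSet
      (gridCube hs k (ofParity ρ m')).toSet := by
  intro m m' hne
  rw [Set.disjoint_left]
  intro x hx hx'
  obtain ⟨i, hi⟩ := Function.ne_iff.1 hne
  have h := hx i
  have h' := hx' i
  simp only [gridCube, ofParity, mem_Ioo] at h h'
  push_cast at h h'
  have ht : 0 < s / 2 ^ k := by positivity
  set t := s / 2 ^ k
  rcases lt_or_gt_of_ne hi with h1 | h1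
  · have h2 : (m i : ℝ) + 1 ≤ m' i := by exact_mod_cast h1
    nlinarith [h.1, h.2, h'.1, h'.2]
  · have h2 : (m' i : ℝ) + 1 ≤ m i := by exact_mod_cast h1
    nlinarith [h.1, h.2, h'.1, h'.2]

theorem card_parity (n : ℕ) : (Finset.univ : Finset (Fin n → Fin 2)).card = 2 ^ n := by
  simp

/-- The vectors `m` whose `k`-th ancestor lies in `M`. -/
def descendants (M : Set (Fin n → ℤ)) (k : ℕ) : Set (Fin n → ℤ) :=
  {m | (fun i => m i / 2 ^ k) ∈ M}

theorem ofParity_mem_descendants_succ {M : Set (Fin n → ℤ)} {k : ℕ} {ρ : Fin n → Fin 2}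
    {m : Fin n → ℤ} : ofParity ρ m ∈ descendants M (k + 1) ↔ m ∈ descendants M k := by
  conv_rhs => rw [← ofParity_ediv ρ m]
  simp only [descendants, mem_ofPred_eq]
  rw [iff_iff_eq]
  congr 1
  funext i
  rw [pow_succ', Int.ediv_ediv_of_nonneg (by norm_num)]

/-- Each of the 2 ^ n parity classes is an admissible disjoint family. -/
theorem tsum_indicator_osc_le {p : ℝ} {u : EuclideanSpace ℝ (Fin n) → ℝ} {A : Set _} {ε : ℝ≥0∞}
    (hosc : ∀ 𝒬 : Set (Cube n), 𝒬.Countable → 𝒬.PairwiseDisjoint Cube.toSet →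
      (∀ Q ∈ 𝒬, Disjoint Q.toSet A) → oscSum p u 𝒬 ≤ ε)
    {s : ℝ} (hs : 0 < s) (k : ℕ) {M : Set (Fin n → ℤ)}
    (hM : ∀ m ∈ M, Disjoint (gridCube hs k m).toSet A) :
    ∑' m, M.indicator (fun m => volume (gridCube hs k m).toSet * eosc u (gridCube hs k m) ^ p) m ≤
      2 ^ n * ε := by
  rw [tsum_eq_sum_parity]
  calc _ ≤ ∑ ρ : Fin n → Fin 2, ε := by
        refine Finset.sum_le_sum fun ρ _ => ?_
        have h1 := tsum_subtype (ofParity ρ ⁻¹' M) (fun m =>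
          volume (gridCube hs k (ofParity ρ m)).toSet * eosc u (gridCube hs k (ofParity ρ m)) ^ p)
        have h2 : Pairwise fun m m' : (ofParity ρ ⁻¹' M) =>
            Disjoint (gridCube hs k (ofParity ρ m)).toSet
              (gridCube hs k (ofParity ρ m')).toSet := fun m m' hne =>
          gridCube_disjoint hs k ρ fun h => hne (Subtype.ext h)
        rw [tsum_eq_oscSum p u (c := fun m : (ofParity ρ ⁻¹' M) =>
          gridCube hs k (ofParity ρ m)) h2] at h1
        refine h1.symm.trans_le (hosc _ (countable_range _) (pairwiseDisjoint_range h2) ?_)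
        rintro _ ⟨m, rfl⟩
        exact hM _ m.2
    _ = _ := by rw [Finset.sum_const, card_parity, nsmul_eq_mul]; norm_cast

theorem tsum_indicator_morrey_le {p : ℝ} (hp : 1 ≤ p) (u : EuclideanSpace ℝ (Fin n) → ℝ)
    {s : ℝ} (hs : 0 < s) {M : Set (Fin n → ℤ)} {B : Cube n} {C : ℝ≥0∞}
    (hM : ∀ m ∈ M, (gridCube hs 0 m).toSet ⊆ B.toSet)
    (hC : ∀ m ∈ M, volume B.toSet ≤ C * volume (gridCube hs 0 m).toSet) :
    ∑' m, M.indicator (fun m => morrey p u (gridCube hs 0 m)) m ≤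
      2 ^ n * (C ^ p * morrey p u B) := by
  rw [tsum_eq_sum_parity]
  calc _ ≤ ∑ ρ : Fin n → Fin 2, C ^ p * morrey p u B := by
        refine Finset.sum_le_sum fun ρ _ => ?_
        refine (tsum_subtype (ofParity ρ ⁻¹' M) (fun m =>
          morrey p u (gridCube hs 0 (ofParity ρ m)))).symm.trans_le ?_
        exact tsum_morrey_le (c := fun m : (ofParity ρ ⁻¹' M) => gridCube hs 0 (ofParity ρ m))
          hp u (fun m m' hne => gridCube_disjoint hs 0 ρ fun h => hne (Subtype.ext h))
          (fun m => hM _ m.2) (fun m => hC _ m.2)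
    _ = _ := by rw [Finset.sum_const, card_parity, nsmul_eq_mul]; norm_cast

/-- The sum of the Morrey quantities over the `k`-th generation of grid cubes. -/
def gridSum (p : ℝ) (u : EuclideanSpace ℝ (Fin n) → ℝ) {s : ℝ} (hs : 0 < s)
    (M : Set (Fin n → ℤ)) (k : ℕ) : ℝ≥0∞ :=
  ∑' m, (descendants M k).indicator (fun m => morrey p u (gridCube hs k m)) m

/-- A child's average is at most its parent's plus 2 ^ n times the parent's oscillation. The 2 ^ n
children each have 2 ^ (-n) of the volume, so the count cancels and only the convexity factor 2 ^ (p
- 1) remains. -/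
theorem gridSum_succ_le {p : ℝ} (hp : 1 ≤ p) {u : EuclideanSpace ℝ (Fin n) → ℝ}
    (hu : LocallyIntegrable u volume) {A : Set _} {ε : ℝ≥0∞}
    (hosc : ∀ 𝒬 : Set (Cube n), 𝒬.Countable → 𝒬.PairwiseDisjoint Cube.toSet →
      (∀ Q ∈ 𝒬, Disjoint Q.toSet A) → oscSum p u 𝒬 ≤ ε)
    {s : ℝ} (hs : 0 < s) {M : Set (Fin n → ℤ)}
    (hM : ∀ m ∈ M, Disjoint (gridCube hs 0 m).toSet A) (k : ℕ) :
    gridSum p u hs M (k + 1) ≤ 2 ^ (p - 1) * (gridSum p u hs M k + (2 ^ n) ^ p * (2 ^ n * ε)) := by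
  have hp0 : 0 ≤ p := by linarith
  have hchild : ∀ (ρ : Fin n → Fin 2) (m : Fin n → ℤ),
      morrey p u (gridCube hs (k + 1) (ofParity ρ m)) ≤ (2 ^ n)⁻¹ * (2 ^ (p - 1) *
        (morrey p u (gridCube hs k m) +
          (2 ^ n) ^ p * (volume (gridCube hs k m).toSet * eosc u (gridCube hs k m) ^ p))) := by
    intro ρ m
    have h1 := gridCube_succ_subset hs k (ofParity ρ m)
    rw [ofParity_ediv] at h1
    have h2 := volume_gridCube_succ hs k (ofParity ρ m) m
    have h3 : volume (gridCube hs (k + 1) (ofParity ρ m)).toSet =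
        (2 ^ n)⁻¹ * volume (gridCube hs k m).toSet := by
      rw [h2, ← mul_assoc, ENNReal.inv_mul_cancel (by simp) (by simp), one_mul]
    unfold morrey
    rw [h3, mul_assoc]
    gcongr (2 ^ n)⁻¹ * ?_
    calc volume (gridCube hs k m).toSet * eavg u (gridCube hs (k + 1) (ofParity ρ m)) ^ p
        ≤ volume (gridCube hs k m).toSet * (2 ^ (p - 1) * (eavg u (gridCube hs k m) ^ p +
            (2 ^ n * eosc u (gridCube hs k m)) ^ p)) := by
          gcongr
          refine le_trans ?_ (add_rpow_le_two_rpow_mul hp _ _)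
          gcongr
          exact eavg_le_eavg_add_eosc hu h1 h2.le
      _ = _ := by rw [ENNReal.mul_rpow_of_nonneg _ _ hp0]; ring
  unfold gridSum
  rw [tsum_eq_sum_parity]
  calc _ ≤ ∑ ρ : Fin n → Fin 2, (2 ^ n)⁻¹ * (2 ^ (p - 1) *
        ((∑' m, (descendants M k).indicator (fun m => morrey p u (gridCube hs k m)) m) +
        (2 ^ n) ^ p * ∑' m, (descendants M k).indicator (fun m =>
          volume (gridCube hs k m).toSet * eosc u (gridCube hs k m) ^ p) m)) := by
        refine Finset.sum_le_sum fun ρ _ => ?_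
        rw [← ENNReal.tsum_mul_left, ← ENNReal.tsum_add, ← ENNReal.tsum_mul_left,
          ← ENNReal.tsum_mul_left]
        refine ENNReal.tsum_le_tsum fun m => ?_
        by_cases hm : m ∈ descendants M k
        · rw [indicator_of_mem (ofParity_mem_descendants_succ.2 hm), indicator_of_mem hm,
            indicator_of_mem hm]
          exact hchild ρ m
        · rw [indicator_of_notMem (mt ofParity_mem_descendants_succ.1 hm)]
          exact zero_le
    _ ≤ ∑ ρ : Fin n → Fin 2, (2 ^ n)⁻¹ * (2 ^ (p - 1) *
        ((∑' m, (descendants M k).indicator (fun m => morrey p u (gridCube hs k m)) m) +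
        (2 ^ n) ^ p * (2 ^ n * ε))) := by
        gcongr
        exact tsum_indicator_osc_le hosc hs k fun m hm =>
          (hM _ hm).mono_left (gridCube_subset_zero hs k m)
    _ = _ := by
        rw [Finset.sum_const, card_parity, nsmul_eq_mul, ← mul_assoc]
        push_cast
        rw [ENNReal.mul_inv_cancel (by simp) (by simp), one_mul]

theorem gridSum_le {p : ℝ} (hp : 1 ≤ p) {u : EuclideanSpace ℝ (Fin n) → ℝ}
    (hu : LocallyIntegrable u volume) {A : Set _} {ε : ℝ≥0∞}
    (hosc : ∀ 𝒬 : Set (Cube n), 𝒬.Countable → 𝒬.PairwiseDisjoint Cube.toSet →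
      (∀ Q ∈ 𝒬, Disjoint Q.toSet A) → oscSum p u 𝒬 ≤ ε)
    {s : ℝ} (hs : 0 < s) {M : Set (Fin n → ℤ)}
    (hM : ∀ m ∈ M, Disjoint (gridCube hs 0 m).toSet A) {c : ℝ≥0∞}
    (h0 : gridSum p u hs M 0 ≤ c) (hc : (2 ^ n) ^ p * (2 ^ n * ε) ≤ c) (k : ℕ) :
    gridSum p u hs M k ≤ (2 ^ (p - 1)) ^ k * ((k + 1) * c) := by
  have hq : (1 : ℝ≥0∞) ≤ 2 ^ (p - 1) :=
    by simpa using ENNReal.rpow_le_rpow_of_exponent_le one_le_two (by linarith : (0 : ℝ) ≤ p - 1)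
  induction k with
  | zero => simpa using h0
  | succ k ih =>
    calc gridSum p u hs M (k + 1)
        ≤ 2 ^ (p - 1) * (gridSum p u hs M k + (2 ^ n) ^ p * (2 ^ n * ε)) :=
          gridSum_succ_le hp hu hosc hs hM k
      _ ≤ 2 ^ (p - 1) * ((2 ^ (p - 1)) ^ k * ((k + 1) * c) + (2 ^ (p - 1)) ^ k * c) := by
          refine mul_le_mul' le_rfl (add_le_add ih (hc.trans ?_))
          exact le_mul_of_one_le_left' (one_le_pow₀ hq)
      _ = _ := by push_cast; ring

/-- Rounding the corner of Q down to the grid displaces it by less than one spacing, and Q is no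
longer than one spacing. This is why grid cubes have twice the spacing as side. -/
theorem exists_gridCube {s : ℝ} (hs : 0 < s) {Q : Cube n} (hQ : Q.side ≤ s) :
    ∃ (k : ℕ) (m : Fin n → ℤ), Q.toSet ⊆ (gridCube hs k m).toSet ∧ Q.side ≤ s / 2 ^ k ∧
      s / 2 ^ k ≤ 2 * Q.side := by
  obtain ⟨k, hk1, hk2⟩ := exists_nat_pow_near_of_lt_one (x := Q.side / s) (y := 1 / 2)
    (div_pos Q.side_pos hs) ((div_le_one hs).2 hQ) (by norm_num) (by norm_num)
  rw [lt_div_iff₀ hs] at hk1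
  rw [div_le_iff₀ hs] at hk2
  have e1 : (1 / 2 : ℝ) ^ k * s = s / 2 ^ k := by rw [one_div, inv_pow]; field_simp
  have e2 : (1 / 2 : ℝ) ^ (k + 1) * s = s / 2 ^ k / 2 := by
    rw [pow_succ, mul_right_comm, e1]; ring
  rw [e1] at hk2
  rw [e2] at hk1
  have ht : 0 < s / 2 ^ k := by positivity
  refine ⟨k, fun i => ⌊Q.corner i / (s / 2 ^ k)⌋, fun x hx i => ?_, hk2, by linarith⟩
  have h := hx i
  have h1 := Int.floor_le (Q.corner i / (s / 2 ^ k))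
  have h2 := Int.lt_floor_add_one (Q.corner i / (s / 2 ^ k))
  rw [le_div_iff₀ ht] at h1
  rw [div_lt_iff₀ ht] at h2
  simp only [gridCube, mem_Ioo] at h ⊢
  constructor <;> linarith [h.1, h.2]

theorem tsum_succ_mul_two_inv_pow_ne_top : ∑' k : ℕ, ((k : ℝ≥0∞) + 1) * 2⁻¹ ^ k ≠ ⊤ := by
  have h1 : Summable fun k : ℕ => ((k : ℝ) + 1) * (1 / 2) ^ k := by
    have h2 := summable_pow_mul_geometric_of_norm_lt_one 1 (r := (1 / 2 : ℝ)) (by norm_num)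
    have h3 := summable_geometric_of_lt_one (r := (1 / 2 : ℝ)) (by norm_num) (by norm_num)
    refine (h2.add h3).congr fun k => ?_
    ring
  refine ne_of_eq_of_ne (tsum_congr fun k => ?_) h1.tsum_ofReal_ne_top
  rw [ENNReal.ofReal_mul (by positivity), ENNReal.ofReal_add (by positivity) (by positivity),
    ENNReal.ofReal_natCast, ENNReal.ofReal_pow (by norm_num), one_div,
    ENNReal.ofReal_inv_of_pos two_pos]
  simp

/-- The weight of cubes of relative side 2 ^ (-k) beats the growth of `gridSum` by a summable
factor. -/
theorem two_inv_pow_rpow_mul (p : ℝ) (k : ℕ) :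
    ((2 : ℝ≥0∞)⁻¹ ^ k) ^ p * (2 ^ (p - 1)) ^ k = 2⁻¹ ^ k := by
  have h : ∀ x : ℝ≥0∞, (x ^ k) ^ p = (x ^ p) ^ k := fun x => by
    rw [← ENNReal.rpow_natCast, ← ENNReal.rpow_mul, mul_comm (k : ℝ) p, ENNReal.rpow_mul,
      ENNReal.rpow_natCast]
  rw [h, ← mul_pow]
  congr 1
  rw [ENNReal.inv_rpow, ← ENNReal.rpow_neg, ← ENNReal.rpow_add _ _ (by simp) (by simp),
    ← ENNReal.rpow_neg_one]
  congr 1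
  ring

/-- The sum over small disjoint cubes `Q` of `side(Q)^p |Q| (⨍_Q |u|)^p`. -/
theorem tsum_side_rpow_mul_morrey_le {p : ℝ} (hp : 1 ≤ p) {u : EuclideanSpace ℝ (Fin n) → ℝ}
    (hu : LocallyIntegrable u volume) {A : Set _} {ε : ℝ≥0∞}
    (hosc : ∀ 𝒬 : Set (Cube n), 𝒬.Countable → 𝒬.PairwiseDisjoint Cube.toSet →
      (∀ Q ∈ 𝒬, Disjoint Q.toSet A) → oscSum p u 𝒬 ≤ ε)
    {s : ℝ} (hs : 0 < s) {M : Set (Fin n → ℤ)}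
    (hM : ∀ m ∈ M, Disjoint (gridCube hs 0 m).toSet A) {c : ℝ≥0∞}
    (h0 : gridSum p u hs M 0 ≤ c) (hc : (2 ^ n) ^ p * (2 ^ n * ε) ≤ c)
    {𝒬 : Set (Cube n)} (h𝒬 : 𝒬.Countable) (hd : 𝒬.PairwiseDisjoint Cube.toSet)
    (hside : ∀ Q ∈ 𝒬, Q.side ≤ s)
    (hQM : ∀ Q ∈ 𝒬, ∀ m, Q.toSet ⊆ (gridCube hs 0 m).toSet → m ∈ M) :
    ∑' Q : 𝒬, ENNReal.ofReal ((Q : Cube n).side / s) ^ p * morrey p u Q ≤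
      (4 ^ n) ^ p * ((∑' k : ℕ, ((k : ℝ≥0∞) + 1) * 2⁻¹ ^ k) * c) := by
  classical
  have hp0 : 0 ≤ p := by linarith
  have := h𝒬.to_subtype
  -- Each cube is assigned one grid cube of comparable size, and the sum is then reorganised along
  -- the fibres of this assignment.
  choose κ μ hsub hle hge using fun Q : 𝒬 => exists_gridCube hs (hside Q Q.2)
  have hfib : ∀ k m, (∑' Q : 𝒬, if μ Q = m then (if κ Q = k then
      ENNReal.ofReal ((Q : Cube n).side / s) ^ p * morrey p u Q else 0) else 0) ≤
      (2⁻¹ ^ k) ^ p * ((4 ^ n) ^ p *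
        (descendants M k).indicator (fun m => morrey p u (gridCube hs k m)) m) := by
    intro k m
    have h1 : (∑' Q : 𝒬, if μ Q = m then (if κ Q = k then
        ENNReal.ofReal ((Q : Cube n).side / s) ^ p * morrey p u Q else 0) else 0) =
        ∑' Q : {Q : 𝒬 | μ Q = m ∧ κ Q = k},
          ENNReal.ofReal (((Q : 𝒬) : Cube n).side / s) ^ p * morrey p u ((Q : 𝒬) : Cube n) := by
      refine Eq.trans ?_ (tsum_subtype {Q : 𝒬 | μ Q = m ∧ κ Q = k} (fun Q : 𝒬 =>
        ENNReal.ofReal ((Q : Cube n).side / s) ^ p * morrey p u (Q : Cube n))).symm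
      refine tsum_congr fun Q => ?_
      rw [indicator_apply, ← ite_and]
      rfl
    rw [h1]
    by_cases hm : m ∈ descendants M k
    · rw [indicator_of_mem hm]
      calc _ ≤ ∑' Q : {Q : 𝒬 | μ Q = m ∧ κ Q = k},
            ((2 : ℝ≥0∞)⁻¹ ^ k) ^ p * morrey p u ((Q : 𝒬) : Cube n) := by
            refine ENNReal.tsum_le_tsum fun Q => ?_
            gcongr
            have h2 := hle Q
            rw [Q.2.2] at h2
            have h3 : ((Q : 𝒬) : Cube n).side / s ≤ 2⁻¹ ^ k := by
              rw [div_le_iff₀ hs, inv_pow]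
              exact h2.trans_eq (by field_simp)
            refine (ENNReal.ofReal_le_ofReal h3).trans_eq ?_
            rw [ENNReal.ofReal_pow (by norm_num), ENNReal.ofReal_inv_of_pos two_pos,
              ENNReal.ofReal_ofNat]
        _ ≤ _ := by
            rw [ENNReal.tsum_mul_left]
            gcongr
            -- Cubes in one fibre are disjoint and have at least a quarter of the side of the grid
            -- cube, whence 4 ^ n.
            refine tsum_morrey_le (c := fun Q : {Q : 𝒬 | μ Q = m ∧ κ Q = k} =>
              ((Q : 𝒬) : Cube n)) hp u (fun Q Q' hne => ?_) (fun Q => ?_) (fun Q => ?_)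
            · exact hd Q.1.2 Q'.1.2 fun h => hne (Subtype.ext (Subtype.ext h))
            · have h2 := hsub Q
              rwa [Q.2.1, Q.2.2] at h2
            · have h2 := hge Q
              rw [Q.2.2] at h2
              have h3 := Cube.volume_le_of_subset (Q := ((Q : 𝒬) : Cube n))
                (Q' := gridCube hs k m) 4 (by norm_num) (by simp only [gridCube]; linarith)
              simpa using h3
    -- The generation-zero ancestor of the assigned grid cube also contains Q, so its index must lie
    -- in M.
    · have : IsEmpty {Q : 𝒬 | μ Q = m ∧ κ Q = k} := by
        refine ⟨fun Q => hm (hQM Q Q.1.2 _ ?_)⟩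
        have h2 := hsub Q
        rw [Q.2.1, Q.2.2] at h2
        exact h2.trans (gridCube_subset_zero hs k m)
      rw [tsum_empty]
      exact zero_le
  calc ∑' Q : 𝒬, ENNReal.ofReal ((Q : Cube n).side / s) ^ p * morrey p u Q
      = ∑' (k : ℕ) (m : Fin n → ℤ) (Q : 𝒬), if μ Q = m then (if κ Q = k then
          ENNReal.ofReal ((Q : Cube n).side / s) ^ p * morrey p u Q else 0) else 0 := by
        have h1 : ∀ k : ℕ, (∑' (m : Fin n → ℤ) (Q : 𝒬), if μ Q = m then (if κ Q = k then
            ENNReal.ofReal ((Q : Cube n).side / s) ^ p * morrey p u Q else 0) else 0) =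
            ∑' Q : 𝒬, if κ Q = k then
              ENNReal.ofReal ((Q : Cube n).side / s) ^ p * morrey p u Q else 0 := by
          intro k
          rw [ENNReal.tsum_comm]
          exact tsum_congr fun Q => tsum_ite_eq' _ _
        simp only [h1]
        rw [ENNReal.tsum_comm]
        exact tsum_congr fun Q => (tsum_ite_eq' (κ Q) fun _ =>
          ENNReal.ofReal ((Q : Cube n).side / s) ^ p * morrey p u (Q : Cube n)).symm
    _ ≤ ∑' (k : ℕ) (m : Fin n → ℤ), (2⁻¹ ^ k) ^ p * ((4 ^ n) ^ p *
        (descendants M k).indicator (fun m => morrey p u (gridCube hs k m)) m) :=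
        ENNReal.tsum_le_tsum fun k => ENNReal.tsum_le_tsum fun m => hfib k m
    _ = ∑' k : ℕ, (2⁻¹ ^ k) ^ p * ((4 ^ n) ^ p * gridSum p u hs M k) := by
        simp only [ENNReal.tsum_mul_left, gridSum]
    _ ≤ ∑' k : ℕ, (4 ^ n) ^ p * ((((k : ℝ≥0∞) + 1) * 2⁻¹ ^ k) * c) := by
        refine ENNReal.tsum_le_tsum fun k => ?_
        calc _ ≤ ((2 : ℝ≥0∞)⁻¹ ^ k) ^ p * ((4 ^ n) ^ p *
              ((2 ^ (p - 1)) ^ k * ((k + 1) * c))) := by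
              gcongr
              exact gridSum_le hp hu hosc hs hM h0 hc k
          _ = (4 ^ n) ^ p * ((((2 : ℝ≥0∞)⁻¹ ^ k) ^ p * (2 ^ (p - 1)) ^ k) * ((k + 1) * c)) := by
              ring
          _ = _ := by rw [two_inv_pow_rpow_mul]; ring
    _ = _ := by rw [ENNReal.tsum_mul_left, ENNReal.tsum_mul_right]

/-! ### Cutting off at infinity -/

theorem le_volume_inter_box {Q : Cube n} {R t : ℝ} (ht : 0 < t) (hQ : t ≤ Q.side)
    (h : (Q.toSet ∩ box n R).Nonempty) :
    ENNReal.ofReal t ^ n ≤ volume (Q.toSet ∩ box n (R + t)) := by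
  obtain ⟨x, hxQ, hx⟩ := h
  -- This corner keeps a cube of side t inside Q, with every coordinate within t of that of x.
  let P : Cube n := ⟨WithLp.toLp 2 fun i => max (Q.corner i) (x i - t), t, ht⟩
  rw [show ENNReal.ofReal t ^ n = volume P.toSet from P.volume_toSet.symm]
  refine measure_mono fun y hy => ⟨fun i => ?_, fun i => ?_⟩
  all_goals
    have h1 := hy i
    have h2 := hxQ i
    have h3 := abs_lt.1 (hx i)
    simp only [P, mem_Ioo, max_lt_iff] at h1 h2
  · have h4 : max (Q.corner i) (x i - t) + t ≤ Q.corner i + Q.side := by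
      rw [max_add]
      exact max_le (by linarith) (by linarith [h2.2])
    exact ⟨h1.1.1, h1.2.trans_le h4⟩
  · have h4 : max (Q.corner i) (x i - t) ≤ x i := max_le h2.1.le (by linarith)
    rw [abs_lt]
    constructor <;> linarith [h1.1.2, h1.2, h3.1, h3.2]

theorem locallyIntegrable_cutoff {u ψ : EuclideanSpace ℝ (Fin n) → ℝ}
    (hu : LocallyIntegrable u volume) (hψ : Continuous ψ) :
    LocallyIntegrable (fun x => ψ x * u x) volume :=
  locallyIntegrableOn_univ.1
    ((hu.locallyIntegrableOn univ).continuousOn_mul hψ.continuousOn isOpen_univ.isLocallyClosed)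

/-- A discrete product rule: ψ u - ψ(y) u_Q = ψ (u - u_Q) + (ψ - ψ(y)) u_Q for a fixed y in Q. -/
theorem eosc_cutoff_le {u ψ : EuclideanSpace ℝ (Fin n) → ℝ} (hu : LocallyIntegrable u volume)
    (hψ : Continuous ψ) (hψ1 : ∀ x, |ψ x| ≤ 1) {Q : Cube n} {t : ℝ} (ht : 0 ≤ t)
    (hQ : ∀ x ∈ Q.toSet, ∀ y ∈ Q.toSet, |ψ x - ψ y| ≤ t) :
    eosc (fun x => ψ x * u x) Q ≤ 2 * (eosc u Q + ENNReal.ofReal t * eavg u Q) := by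
  obtain ⟨y, hy⟩ := Q.nonempty
  refine (eosc_le_two_mul (locallyIntegrable_cutoff hu hψ) (ψ y * avg u Q) Q).trans ?_
  gcongr 2 * ?_
  calc eavg (fun x => ψ x * u x - ψ y * avg u Q) Q
      ≤ eavg (fun x => u x - avg u Q) Q + eavg (fun _ => t * avg u Q) Q := by
        refine eavg_add_le ((aemeasurable_cube hu Q).sub_const _) fun x hx => ?_
        rw [show ψ x * u x - ψ y * avg u Q = ψ x * (u x - avg u Q) + (ψ x - ψ y) * avg u Q by ring]
        refine (enorm_add_le _ _).trans ?_
        simp only [enorm_mul, Real.enorm_eq_ofReal_abs]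
        refine add_le_add (mul_le_of_le_one_left' ?_) (mul_le_mul' (ENNReal.ofReal_le_ofReal
          ((hQ x hx y hy).trans (le_abs_self t))) le_rfl)
        rw [ENNReal.ofReal_le_one]
        exact hψ1 x
    _ ≤ _ := by
        rw [← eosc_eq hu, eavg_const, enorm_mul, Real.enorm_eq_ofReal ht]
        gcongr
        exact enorm_avg_le u Q

/-- Each cube lies in a centred cube of comparable size, because N L < 8 N side. There are boundedly
many: each takes up volume at least (L / 8) ^ n of the box of half-side (N + 1) L. -/
theorem tsum_large_cubes_le {p : ℝ} (hp : 1 ≤ p) {N : ℝ} (hN : 1 ≤ N)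
    {u : EuclideanSpace ℝ (Fin n) → ℝ} {L : ℝ} (hL : 0 < L) {ε : ℝ≥0∞}
    (hmor : ∀ (R : ℝ) (hR : 0 < R), L ≤ R → morrey p u (centredCube n R hR) ≤ ε)
    {𝒬 : Set (Cube n)} (h𝒬 : 𝒬.Countable) (hd : 𝒬.PairwiseDisjoint Cube.toSet)
    (hmeet : ∀ Q ∈ 𝒬, (Q.toSet ∩ box n (N * L)).Nonempty) (hside : ∀ Q ∈ 𝒬, L / 8 < Q.side) :
    ∑' Q : 𝒬, morrey p u (Q : Cube n) ≤
      ENNReal.ofReal (16 * (N + 1)) ^ n * ((ENNReal.ofReal (2 * (8 * N + 1)) ^ n) ^ p * ε) := by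
  have := h𝒬.to_subtype
  have h8 : 0 < L / 8 := by positivity
  have hterm : ∀ Q ∈ 𝒬, morrey p u Q ≤ (ENNReal.ofReal (2 * (8 * N + 1)) ^ n) ^ p * ε := by
    intro Q hQ
    have hℓ := hside Q hQ
    have hR : 0 < (8 * N + 1) * Q.side := mul_pos (by linarith) Q.side_pos
    have hLR : L ≤ (8 * N + 1) * Q.side := by nlinarith [Q.side_pos]
    refine (morrey_le_of_subset (by linarith) u (Q' := centredCube n _ hR) ?_ ?_).trans
      (mul_le_mul' le_rfl (hmor _ hR hLR))
    · rw [centredCube_toSet]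
      exact (Cube.subset_box_add (hmeet Q hQ)).trans (box_mono (by nlinarith))
    · refine Cube.volume_le_of_subset _ (by linarith) ?_
      simp only [centredCube]
      exact (by ring : 2 * ((8 * N + 1) * Q.side) = 2 * (8 * N + 1) * Q.side).le
  have hcount : (∑' _ : 𝒬, (1 : ℝ≥0∞)) ≤ ENNReal.ofReal (16 * (N + 1)) ^ n := by
    have hv : ENNReal.ofReal (L / 8) ^ n ≠ 0 :=
      (ENNReal.pow_pos (ENNReal.ofReal_pos.2 h8) n).ne'
    have hv' : ENNReal.ofReal (L / 8) ^ n ≠ ⊤ := ENNReal.pow_ne_top ENNReal.ofReal_ne_top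
    have hB : 0 < (N + 1) * L := by positivity
    have h1 : ∑' Q : 𝒬, ENNReal.ofReal (L / 8) ^ n ≤
        ENNReal.ofReal (L / 8) ^ n * ENNReal.ofReal (16 * (N + 1)) ^ n := by
      calc ∑' Q : 𝒬, ENNReal.ofReal (L / 8) ^ n
          ≤ ∑' Q : 𝒬, volume ((Q : Cube n).toSet ∩ box n ((N + 1) * L)) := by
            refine ENNReal.tsum_le_tsum fun Q => ?_
            refine (le_volume_inter_box h8 (hside Q Q.2).le (hmeet Q Q.2)).trans
              (measure_mono (inter_subset_inter_right _ (box_mono ?_)))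
            linarith
        _ = volume (⋃ Q : 𝒬, (Q : Cube n).toSet ∩ box n ((N + 1) * L)) := by
            rw [measure_iUnion]
            · intro Q Q' hne
              exact (hd Q.2 Q'.2 fun h => hne (Subtype.ext h)).mono inter_subset_left
                inter_subset_left
            · intro Q
              rw [← centredCube_toSet hB]
              exact (Cube.measurableSet _).inter (Cube.measurableSet _)
        _ ≤ volume (centredCube n _ hB).toSet := by
            rw [centredCube_toSet]
            exact measure_mono (iUnion_subset fun Q => inter_subset_right)
        _ = _ := by
            rw [Cube.volume_toSet, ← mul_pow, ← ENNReal.ofReal_mul h8.le]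
            simp only [centredCube]
            congr 2
            ring
    calc (∑' _ : 𝒬, (1 : ℝ≥0∞))
        = (ENNReal.ofReal (L / 8) ^ n)⁻¹ * ∑' Q : 𝒬, ENNReal.ofReal (L / 8) ^ n := by
          rw [← ENNReal.tsum_mul_left, ENNReal.inv_mul_cancel hv hv']
      _ ≤ (ENNReal.ofReal (L / 8) ^ n)⁻¹ *
          (ENNReal.ofReal (L / 8) ^ n * ENNReal.ofReal (16 * (N + 1)) ^ n) := by gcongr
      _ = _ := by rw [← mul_assoc, ENNReal.inv_mul_cancel hv hv', one_mul]
  calc ∑' Q : 𝒬, morrey p u (Q : Cube n)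
      ≤ ∑' Q : 𝒬, 1 * ((ENNReal.ofReal (2 * (8 * N + 1)) ^ n) ^ p * ε) :=
        ENNReal.tsum_le_tsum fun Q => by rw [one_mul]; exact hterm Q Q.2
    _ ≤ _ := by
        rw [ENNReal.tsum_mul_right]
        gcongr

theorem tsum_small_cubes_le {p : ℝ} (hp : 1 ≤ p) {N : ℝ} (hN : 1 ≤ N)
    {u : EuclideanSpace ℝ (Fin n) → ℝ} (hu : LocallyIntegrable u volume)
    {L : ℝ} (hL : 0 < L) {ε : ℝ≥0∞}
    (hosc : ∀ 𝒬 : Set (Cube n), 𝒬.Countable → 𝒬.PairwiseDisjoint Cube.toSet →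
      (∀ Q ∈ 𝒬, Disjoint Q.toSet (box n (L / 2))) → oscSum p u 𝒬 ≤ ε)
    (hmor : ∀ (R : ℝ) (hR : 0 < R), L ≤ R → morrey p u (centredCube n R hR) ≤ ε)
    {𝒬 : Set (Cube n)} (h𝒬 : 𝒬.Countable) (hd : 𝒬.PairwiseDisjoint Cube.toSet)
    (hmeet : ∀ Q ∈ 𝒬, (Q.toSet ∩ box n (N * L)).Nonempty) (hside : ∀ Q ∈ 𝒬, Q.side ≤ L / 8)
    (hout : ∀ Q ∈ 𝒬, ¬ Q.toSet ⊆ box n L) :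
    ∑' Q : 𝒬, ENNReal.ofReal ((Q : Cube n).side / (L / 8)) ^ p * morrey p u Q ≤
      (4 ^ n) ^ p * ((∑' k : ℕ, ((k : ℝ≥0∞) + 1) * 2⁻¹ ^ k) *
        ((2 ^ n * (ENNReal.ofReal (8 * (N + 1)) ^ n) ^ p + (2 ^ n) ^ p * 2 ^ n) * ε)) := by
  have h8 : 0 < L / 8 := by positivity
  have hB : 0 < (N + 1) * L := by positivity
  -- These generation-zero cubes have side L / 4. Hence they avoid the box of half-side L / 2, where
  -- the tail estimate needs it, and lie in the box of half-side (N + 1) L, where decay applies.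
  let M : Set (Fin n → ℤ) := {m | ((gridCube h8 0 m).toSet ∩ box n (N * L)).Nonempty ∧
    ¬ (gridCube h8 0 m).toSet ⊆ box n L}
  have hs : ∀ m : Fin n → ℤ, (gridCube h8 0 m).side = L / 4 := fun m => by
    simp only [gridCube]; ring
  refine tsum_side_rpow_mul_morrey_le hp hu hosc h8 (M := M) ?_ ?_ ?_ h𝒬 hd hside ?_
  · rintro m ⟨-, hm⟩
    refine (Cube.disjoint_box_sub hm).mono_right (box_mono ?_)
    rw [hs]
    linarith
  · have h1 : descendants M 0 = M := by
      ext m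
      simp [descendants]
    rw [gridSum, h1, add_mul]
    refine le_trans ?_ le_self_add
    refine (tsum_indicator_morrey_le hp u h8 (B := centredCube n _ hB)
      (C := ENNReal.ofReal (8 * (N + 1)) ^ n) ?_ ?_).trans ?_
    · rintro m ⟨hm, -⟩
      rw [centredCube_toSet]
      refine (Cube.subset_box_add hm).trans (box_mono ?_)
      rw [hs]
      linarith
    · intro m _
      refine Cube.volume_le_of_subset _ (by linarith) ?_
      rw [hs]
      simp only [centredCube]
      linarith
    · rw [← mul_assoc]
      gcongr
      exact hmor _ hB (by nlinarith)
  · rw [add_mul, ← mul_assoc ((2 ^ n) ^ p)]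
    exact le_add_self
  · intro Q hQ m hm
    exact ⟨(hmeet Q hQ).mono (inter_subset_inter_left _ hm), fun h => hout Q hQ (hm.trans h)⟩

/-- Multiplying by a function which vanishes on a large box and is `1` outside a multiple of that
box makes the oscillation sums small. -/
theorem exists_oscSum_cutoff_le (n : ℕ) {p : ℝ} (hp : 1 ≤ p) {N : ℝ} (hN : 1 ≤ N) {Λ : ℝ}
    (hΛ : 0 ≤ Λ) : ∃ C : ℝ≥0∞, C ≠ ⊤ ∧ ∀ (u ψ : EuclideanSpace ℝ (Fin n) → ℝ) (L : ℝ) (ε : ℝ≥0∞),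
      LocallyIntegrable u volume → Continuous ψ → 0 < L → (∀ x, |ψ x| ≤ 1) →
      (∀ x ∈ box n L, ψ x = 0) → (∀ x ∉ box n (N * L), ψ x = 1) →
      (∀ Q : Cube n, ∀ x ∈ Q.toSet, ∀ y ∈ Q.toSet, |ψ x - ψ y| ≤ Λ * (Q.side / L)) →
      (∀ 𝒬 : Set (Cube n), 𝒬.Countable → 𝒬.PairwiseDisjoint Cube.toSet →
        (∀ Q ∈ 𝒬, Disjoint Q.toSet (box n (L / 2))) → oscSum p u 𝒬 ≤ ε) →
      (∀ (R : ℝ) (hR : 0 < R), L ≤ R → morrey p u (centredCube n R hR) ≤ ε) →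
      ∀ 𝒬 : Set (Cube n), 𝒬.Countable → 𝒬.PairwiseDisjoint Cube.toSet →
        oscSum p (fun x => ψ x * u x) 𝒬 ≤ C * ε := by
  have hp0 : 0 ≤ p := by linarith
  have hpow : ∀ x : ℝ≥0∞, x ≠ ⊤ → x ^ p ≠ ⊤ := fun x hx => ENNReal.rpow_ne_top_of_nonneg hp0 hx
  set C₂ : ℝ≥0∞ :=
    ENNReal.ofReal (16 * (N + 1)) ^ n * (ENNReal.ofReal (2 * (8 * N + 1)) ^ n) ^ p with hC₂
  set C₃ : ℝ≥0∞ := (4 ^ n) ^ p * ((∑' k : ℕ, ((k : ℝ≥0∞) + 1) * 2⁻¹ ^ k) *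
    (2 ^ n * (ENNReal.ofReal (8 * (N + 1)) ^ n) ^ p + (2 ^ n) ^ p * 2 ^ n)) with hC₃
  -- From (2 (a + b)) ^ p ≤ 2 ^ p 2 ^ (p - 1) (a ^ p + b ^ p).
  set K : ℝ≥0∞ := 2 ^ p * 2 ^ (p - 1) with hK
  have hK1 : 1 ≤ K := by
    have h1 : (1 : ℝ≥0∞) ≤ 2 ^ p := by
      simpa using ENNReal.rpow_le_rpow_of_exponent_le one_le_two hp0
    have h2 : (1 : ℝ≥0∞) ≤ 2 ^ (p - 1) := by
      simpa using ENNReal.rpow_le_rpow_of_exponent_le one_le_two (by linarith : (0 : ℝ) ≤ p - 1)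
    exact one_le_mul h1 h2
  refine ⟨K + 2 ^ p * C₂ + K * ENNReal.ofReal Λ ^ p * C₃, ?_, ?_⟩
  · have h1 : K ≠ ⊤ := ENNReal.mul_ne_top (hpow _ (by simp))
      (ENNReal.rpow_ne_top_of_nonneg (by linarith) (by simp))
    have h2 : C₂ ≠ ⊤ := ENNReal.mul_ne_top (ENNReal.pow_ne_top ENNReal.ofReal_ne_top)
      (hpow _ (ENNReal.pow_ne_top ENNReal.ofReal_ne_top))
    have h3 : C₃ ≠ ⊤ := by
      refine ENNReal.mul_ne_top (hpow _ (by simp)) (ENNReal.mul_ne_top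
        tsum_succ_mul_two_inv_pow_ne_top (ENNReal.add_ne_top.2 ⟨ENNReal.mul_ne_top (by simp)
          (hpow _ (ENNReal.pow_ne_top ENNReal.ofReal_ne_top)), ENNReal.mul_ne_top
          (hpow _ (by simp)) (by simp)⟩))
    exact ENNReal.add_ne_top.2 ⟨ENNReal.add_ne_top.2 ⟨h1, ENNReal.mul_ne_top (hpow _ (by simp)) h2⟩,
      ENNReal.mul_ne_top (ENNReal.mul_ne_top h1 (hpow _ ENNReal.ofReal_ne_top)) h3⟩
  intro u ψ L ε hu hψ hL hψ1 hψ0 hψN hLip hosc hmor 𝒬 h𝒬 hd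
  have hw := locallyIntegrable_cutoff hu hψ
  set w : EuclideanSpace ℝ (Fin n) → ℝ := fun x => ψ x * u x with hwdef
  -- The three families may overlap: a small transition cube is charged to both `𝒬₁` (oscillation of
  -- u) and `𝒬₃` (variation of ψ). Small cubes inside `box n L` are charged to none, since ψ
  -- vanishes there.
  let 𝒬₁ : Set (Cube n) := {Q ∈ 𝒬 | Disjoint Q.toSet (box n (L / 2))}
  let 𝒬₂ : Set (Cube n) := {Q ∈ 𝒬 | (Q.toSet ∩ box n (N * L)).Nonempty ∧ L / 8 < Q.side}
  let 𝒬₃ : Set (Cube n) := {Q ∈ 𝒬 | (Q.toSet ∩ box n (N * L)).Nonempty ∧ Q.side ≤ L / 8 ∧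
    ¬ Q.toSet ⊆ box n L}
  have s₁ : 𝒬₁ ⊆ 𝒬 := sep_subset _ _
  have s₂ : 𝒬₂ ⊆ 𝒬 := sep_subset _ _
  have s₃ : 𝒬₃ ⊆ 𝒬 := sep_subset _ _
  let F₁ : Cube n → ℝ≥0∞ := fun Q => volume Q.toSet * eosc u Q ^ p
  let F₂ : Cube n → ℝ≥0∞ := fun Q => morrey p u Q
  let F₃ : Cube n → ℝ≥0∞ := fun Q => ENNReal.ofReal (Q.side / (L / 8)) ^ p * morrey p u Q
  have b₁ : ∑' Q, 𝒬₁.indicator F₁ Q ≤ ε := by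
    rw [← tsum_subtype]
    exact hosc 𝒬₁ (h𝒬.mono s₁) (hd.subset s₁) fun Q hQ => hQ.2
  have b₂ : ∑' Q, 𝒬₂.indicator F₂ Q ≤ C₂ * ε := by
    rw [← tsum_subtype, hC₂, mul_assoc]
    exact tsum_large_cubes_le hp hN hL hmor (h𝒬.mono s₂) (hd.subset s₂)
      (fun Q hQ => hQ.2.1) fun Q hQ => hQ.2.2
  have b₃ : ∑' Q, 𝒬₃.indicator F₃ Q ≤ C₃ * ε := by
    rw [← tsum_subtype, hC₃, mul_assoc, mul_assoc]
    exact tsum_small_cubes_le hp hN hu hL hosc hmor (h𝒬.mono s₃) (hd.subset s₃)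
      (fun Q hQ => hQ.2.1) (fun Q hQ => hQ.2.2.1) fun Q hQ => hQ.2.2.2
  have hmain : ∀ Q ∈ 𝒬, volume Q.toSet * eosc w Q ^ p ≤ K * 𝒬₁.indicator F₁ Q +
      2 ^ p * 𝒬₂.indicator F₂ Q + K * ENNReal.ofReal Λ ^ p * 𝒬₃.indicator F₃ Q := by
    intro Q hQ
    by_cases hmeet : (Q.toSet ∩ box n (N * L)).Nonempty
    · rcases lt_or_ge (L / 8) Q.side with hside | hside
      · have hQ₂ : Q ∈ 𝒬₂ := ⟨hQ, hmeet, hside⟩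
        rw [indicator_of_mem hQ₂]
        refine le_trans ?_ (le_self_add.trans' le_add_self)
        calc volume Q.toSet * eosc w Q ^ p ≤ volume Q.toSet * (2 * eavg u Q) ^ p := by
              gcongr
              refine (eosc_le_two_mul_eavg hw Q).trans ?_
              gcongr
              refine eavg_mono fun x _ => ?_
              rw [hwdef, enorm_mul]
              refine mul_le_of_le_one_left' ?_
              rw [Real.enorm_eq_ofReal_abs, ENNReal.ofReal_le_one]
              exact hψ1 x
          _ = 2 ^ p * F₂ Q := by
              simp only [F₂, morrey]
              rw [ENNReal.mul_rpow_of_nonneg _ _ hp0]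
              ring
      · by_cases hin : Q.toSet ⊆ box n L
        · have h1 : eosc w Q = 0 := by
            have h2 : eavg w Q = 0 := by
              rw [eavg_congr (v := fun _ => 0) fun x hx => by rw [hwdef]; simp [hψ0 x (hin hx)],
                eavg_const, enorm_zero]
            have h3 := eosc_le_two_mul_eavg hw Q
            rw [h2, mul_zero] at h3
            exact le_zero_iff.1 h3
          rw [h1, ENNReal.zero_rpow_of_pos (by linarith), mul_zero]
          exact zero_le
        · have hQ₁ : Q ∈ 𝒬₁ := ⟨hQ, (Cube.disjoint_box_sub hin).mono_right (box_mono (by linarith))⟩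
          have hQ₃ : Q ∈ 𝒬₃ := ⟨hQ, hmeet, hside, hin⟩
          rw [indicator_of_mem hQ₁, indicator_of_mem hQ₃]
          have hsp := Q.side_pos
          have h1 := eosc_cutoff_le hu hψ hψ1 (by positivity) (hLip Q)
          have h2 : ENNReal.ofReal (Λ * (Q.side / L)) ≤
              ENNReal.ofReal Λ * ENNReal.ofReal (Q.side / (L / 8)) := by
            rw [← ENNReal.ofReal_mul hΛ]
            gcongr
            linarith
          calc volume Q.toSet * eosc w Q ^ p
              ≤ volume Q.toSet * (2 * (eosc u Q +
                  ENNReal.ofReal Λ * ENNReal.ofReal (Q.side / (L / 8)) * eavg u Q)) ^ p := by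
                gcongr
                exact h1.trans (by gcongr)
            _ ≤ volume Q.toSet * (2 ^ p * (2 ^ (p - 1) * (eosc u Q ^ p +
                  (ENNReal.ofReal Λ * ENNReal.ofReal (Q.side / (L / 8)) * eavg u Q) ^ p))) := by
                rw [ENNReal.mul_rpow_of_nonneg _ _ hp0]
                gcongr
                exact add_rpow_le_two_rpow_mul hp _ _
            _ = K * F₁ Q + K * ENNReal.ofReal Λ ^ p * F₃ Q := by
                simp only [F₁, F₃, morrey, hK]
                rw [ENNReal.mul_rpow_of_nonneg _ _ hp0, ENNReal.mul_rpow_of_nonneg _ _ hp0]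
                ring
            _ ≤ _ := by
                gcongr
                exact le_self_add
    · have hdis : Disjoint Q.toSet (box n (N * L)) :=
        disjoint_iff_inter_eq_empty.2 (not_nonempty_iff_eq_empty.1 hmeet)
      have hQ₁ : Q ∈ 𝒬₁ := ⟨hQ, hdis.mono_right (box_mono (by nlinarith))⟩
      rw [indicator_of_mem hQ₁, add_assoc]
      refine le_trans ?_ le_self_add
      have h1 : eosc w Q = eosc u Q := eosc_congr hw hu fun x hx => by
        rw [hwdef]
        simp [hψN x (Set.disjoint_left.1 hdis hx)]
      rw [h1]
      exact le_mul_of_one_le_left' hK1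
  rw [oscSum_eq, tsum_subtype 𝒬 fun Q : Cube n => volume Q.toSet * eosc w Q ^ p]
  calc ∑' Q, 𝒬.indicator (fun Q : Cube n => volume Q.toSet * eosc w Q ^ p) Q
      ≤ ∑' Q, (K * 𝒬₁.indicator F₁ Q + 2 ^ p * 𝒬₂.indicator F₂ Q +
          K * ENNReal.ofReal Λ ^ p * 𝒬₃.indicator F₃ Q) :=
        ENNReal.tsum_le_tsum fun Q => indicator_le (fun Q hQ => hmain Q hQ) Q
    _ = K * (∑' Q, 𝒬₁.indicator F₁ Q) + 2 ^ p * (∑' Q, 𝒬₂.indicator F₂ Q) +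
          K * ENNReal.ofReal Λ ^ p * ∑' Q, 𝒬₃.indicator F₃ Q := by
        rw [ENNReal.tsum_add, ENNReal.tsum_add, ENNReal.tsum_mul_left, ENNReal.tsum_mul_left,
          ENNReal.tsum_mul_left]
    _ ≤ K * ε + 2 ^ p * (C₂ * ε) + K * ENNReal.ofReal Λ ^ p * (C₃ * ε) := by gcongr
    _ = _ := by ring

/-! ### Approximation by compactly supported smooth functions -/

theorem norm_le_of_forall_abs_le {x : EuclideanSpace ℝ (Fin n)} {t : ℝ} (ht : 0 ≤ t)
    (h : ∀ i, |x i| ≤ t) : ‖x‖ ≤ n * t := by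
  rw [EuclideanSpace.norm_eq, Real.sqrt_le_iff]
  refine ⟨by positivity, ?_⟩
  calc ∑ i, ‖x i‖ ^ 2 ≤ ∑ _i : Fin n, t ^ 2 := by
        gcongr with i
        exact h i
    _ = n * t ^ 2 := by simp
    _ ≤ (n * t) ^ 2 := by
        rw [mul_pow]
        gcongr
        exact_mod_cast Nat.le_self_pow two_ne_zero n

/-- Smooth cutoff functions at all scales, with uniform Lipschitz bounds. -/
theorem exists_cutoff (hn : 1 ≤ n) : ∃ Λ : ℝ, 0 ≤ Λ ∧ ∀ L : ℝ, 0 < L →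
    ∃ φ : EuclideanSpace ℝ (Fin n) → ℝ, ContDiff ℝ ∞ φ ∧ HasCompactSupport φ ∧
      (∀ x, 0 ≤ φ x) ∧ (∀ x, φ x ≤ 1) ∧ (∀ x ∈ box n L, φ x = 1) ∧
      (∀ x ∉ box n (2 * n * L), φ x = 0) ∧
      ∀ Q : Cube n, ∀ x ∈ Q.toSet, ∀ y ∈ Q.toSet, |φ x - φ y| ≤ Λ * (Q.side / L) := by
  have hn0 : (0 : ℝ) < n := by exact_mod_cast hn
  -- A point of `box n L` has norm at most n L, and one outside `box n (2 * n * L)` has norm at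
  -- least 2 n L. Rescaling a single bump gives a Lipschitz constant proportional to 1 / L.
  let Φ : ContDiffBump (0 : EuclideanSpace ℝ (Fin n)) := ⟨n, 2 * n, hn0, by linarith⟩
  have hΦ : ContDiff ℝ ∞ Φ := Φ.contDiff
  obtain ⟨C, hC⟩ := hΦ.lipschitzWith_of_hasCompactSupport Φ.hasCompactSupport (by simp)
  refine ⟨C * n, by positivity, fun L hL => ⟨fun x => Φ (L⁻¹ • x), ?_, ?_, fun x => Φ.nonneg,
    fun x => Φ.le_one, fun x hx => ?_, fun x hx => ?_, fun Q x hx y hy => ?_⟩⟩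
  · exact hΦ.comp (contDiff_const_smul _)
  · exact Φ.hasCompactSupport.comp_smul (inv_ne_zero hL.ne')
  · refine Φ.one_of_mem_closedBall ?_
    rw [mem_closedBall_zero_iff, norm_smul, norm_inv, Real.norm_of_nonneg hL.le,
      inv_mul_le_iff₀ hL, mul_comm]
    exact norm_le_of_forall_abs_le hL.le fun i => (hx i).le
  · refine Φ.zero_of_le_dist ?_
    simp only [box, mem_ofPred_eq, not_forall, not_lt] at hx
    obtain ⟨i, hi⟩ := hx
    rw [dist_zero_right, norm_smul, norm_inv, Real.norm_of_nonneg hL.le, le_inv_mul_iff₀ hL,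
      mul_comm]
    exact hi.trans (PiLp.norm_apply_le x i)
  · have h1 := hC.dist_le_mul (L⁻¹ • x) (L⁻¹ • y)
    rw [Real.dist_eq, dist_smul₀, dist_eq_norm, norm_inv, Real.norm_of_nonneg hL.le] at h1
    have h2 : ‖x - y‖ ≤ n * Q.side := norm_le_of_forall_abs_le Q.side_pos.le fun i => by
      have hxi := hx i
      have hyi := hy i
      rw [PiLp.sub_apply, abs_le]
      constructor <;> linarith [hxi.1, hxi.2, hyi.1, hyi.2]
    refine h1.trans ?_
    calc (C : ℝ) * (L⁻¹ * ‖x - y‖) ≤ C * (L⁻¹ * (n * Q.side)) := by gcongr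
      _ = _ := by field_simp

/-- Smooth functions in `JN_p` are limits of smooth functions with compact support. -/
theorem exists_smoothCompact_jnNorm_sub_le (hn : 1 ≤ n) {p : ℝ} (hp : 1 < p)
    {g : EuclideanSpace ℝ (Fin n) → ℝ} (hg : ContDiff ℝ ∞ g) (hJN : g ∈ JN n p)
    {ε : ℝ≥0∞} (hε : ε ≠ 0) : ∃ h ∈ smoothCompact n, jnNorm p (g - h) ≤ ε := by
  have hp0 : 0 < p := by linarith
  have hn1 : (1 : ℝ) ≤ n := by exact_mod_cast hn
  obtain ⟨Λ, hΛ, hcut⟩ := exists_cutoff hn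
  obtain ⟨C, hC, hmain⟩ :=
    exists_oscSum_cutoff_le n hp.le (N := 2 * n) (by linarith) hΛ
  obtain ⟨b, hb⟩ := exists_morrey_centredCube_le hn hp hJN
  -- This threshold is nonzero because C is finite and independent of L; L can therefore be chosen
  -- after it.
  have hδ : ε ^ p / C ≠ 0 := ENNReal.div_ne_zero.2
    ⟨fun h => hε ((ENNReal.rpow_eq_zero_iff_of_pos hp0).1 h), hC⟩
  obtain ⟨L₀, hL₀⟩ := hb _ hδ
  obtain ⟨R₀, hR₀⟩ := exists_box_oscSum_le hp0 hJN.2 hδ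
  -- The bound L ≥ 2 R₀ makes cubes avoiding `box n (L / 2)` avoid `box n R₀`, and L ≥ L₀ puts all
  -- centred cubes at scale L or more in the decay range.
  set L : ℝ := max 1 (max L₀ (2 * R₀)) with hLdef
  have hL : 0 < L := lt_max_of_lt_left one_pos
  have hLL : L₀ ≤ L := (le_max_left _ _).trans (le_max_right _ _)
  have hLR : 2 * R₀ ≤ L := (le_max_right _ _).trans (le_max_right _ _)
  obtain ⟨φ, hφ, hφc, hφ0, hφ1, hφin, hφout, hφLip⟩ := hcut L hL
  have hul := locallyIntegrable_sub_const hJN.1 b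
  have hψ : Continuous fun x => 1 - φ x := continuous_const.sub hφ.continuous
  refine ⟨fun x => φ x * (g x - b), ⟨hφ.mul (hg.sub contDiff_const), hφc.mul_right⟩, ?_⟩
  have hsub : g - (fun x => φ x * (g x - b)) = fun x => (1 - φ x) * (g x - b) - -b := by
    funext x
    rw [Pi.sub_apply]
    ring
  rw [hsub, jnNorm_le_iff hp0]
  intro 𝒬 h𝒬 hd
  have hshift : oscSum p (fun x => (1 - φ x) * (g x - b) - -b) 𝒬 =
      oscSum p (fun x => (1 - φ x) * (g x - b)) 𝒬 := by
    simp only [oscSum_eq, eosc_sub_const (locallyIntegrable_cutoff hul hψ)]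
  rw [hshift]
  refine (hmain (fun x => g x - b) (fun x => 1 - φ x) L _ hul hψ hL ?_ ?_ ?_ ?_ ?_ ?_ 𝒬 h𝒬
    hd).trans ENNReal.mul_div_le
  · intro x
    rw [abs_le]
    constructor <;> linarith [hφ0 x, hφ1 x]
  · intro x hx
    rw [hφin x hx, sub_self]
  · intro x hx
    rw [hφout x hx, sub_zero]
  · intro Q x hx y hy
    rw [sub_sub_sub_cancel_left, abs_sub_comm]
    exact hφLip Q x hx y hy
  · intro 𝒬' h1 h2 h3
    have h4 : oscSum p (fun x => g x - b) 𝒬' = oscSum p g 𝒬' := by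
      simp only [oscSum_eq, eosc_sub_const hJN.1]
    rw [h4]
    exact hR₀ 𝒬' h1 h2 fun Q hQ => (h3 Q hQ).mono_right (box_mono (by linarith))
  · exact fun R hR hLR' => hL₀ R hR (hLL.trans hLR')

theorem VJN_subset_CJN (hn : 1 ≤ n) {p : ℝ} (hp : 1 < p) : VJN n p ⊆ CJN n p := by
  rintro f ⟨hf, happ⟩
  refine ⟨hf, fun ε hε => ?_⟩
  set η : ℝ≥0∞ := min ε 1 with hη
  have hη0 : η ≠ 0 := (lt_min hε one_pos).ne'
  have hηt : η ≠ ⊤ := ne_top_of_le_ne_top ENNReal.one_ne_top (min_le_right _ _)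
  -- Two errors and the factor 2 of `jnNorm_add_le` turn η / 2 / 4 into η / 2; truncation at 1 keeps
  -- η finite, so that η / 2 < η strictly.
  have hτ : η / 2 / 4 ≠ 0 := by simp [hη0]
  obtain ⟨g, ⟨hg, hgJN⟩, hfg⟩ := happ _ (pos_iff_ne_zero.2 hτ)
  obtain ⟨h, hh, hgh⟩ := exists_smoothCompact_jnNorm_sub_le hn hp hg.1 hgJN hτ
  have hhl : LocallyIntegrable h volume := hh.1.continuous.locallyIntegrable
  refine ⟨h, hh, ?_⟩
  calc jnNorm p (f - h) = jnNorm p ((f - g) + (g - h)) := by rw [sub_add_sub_cancel]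
    _ ≤ 2 * (jnNorm p (f - g) + jnNorm p (g - h)) :=
        jnNorm_add_le hp.le (hf.1.sub hgJN.1) (hgJN.1.sub hhl)
    _ ≤ 2 * (η / 2 / 4 + η / 2 / 4) := by gcongr
    _ = 4 * (η / 2 / 4) := by ring
    _ = η / 2 := ENNReal.mul_div_cancel (by norm_num) (by norm_num)
    _ < η := ENNReal.half_lt_self hη0 hηt
    _ ≤ ε := min_le_left _ _

end JohnNirenberg

end

theorem mainTheorem1 (n : ℕ) (hn : 1 ≤ n) (p : ℝ) (hp : 1 < p) :
    JohnNirenberg.CJN n p = JohnNirenberg.VJN n p :=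
  (JohnNirenberg.CJN_subset_VJN hp).antisymm (JohnNirenberg.VJN_subset_CJN hn hp)
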